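/- Let $\mu$ be a finite positive Borel measure on the unit circle $\mathbb T$ with infinite support, and let $U^\mu$ be the operator $f(z)\mapsto zf(z)$ on $L^2_\mu$. Let $(\varphi_k)_{k\ge 0}$ be the orthonormal polynomials of $\mu$ ($\deg\varphi_k=k$, positive leading coefficient), $\varphi_k^*(z)=z^k\overline{\varphi_k(1/\bar z)}$, let $a_k$ $(k\ge1)$ be the Schur parameters of $\mu$, i.e. $a_k$ is $\varphi_k(0)$ divided by the leading coefficient of $\varphi_k$, and $\rho_k=\sqrt{1-|a_k|^2}$. For $m\in\mathbb Z$ and an integer $n\ge 0$ let $\mathbb P_{m,n}=\operatorname{span}\{z^m,z^{m+1},\dots,z^{m+n-1}\}\subset L^2_\mu$. For $n\ge1$ and $u\in\mathbb T$ put $$p_n^u(z)=z\varphi_{n-1}(z)+u\,\varphi_{n-1}^*(z),\qquad q_n^u(z)=\varphi_n^*(z)-\bar u\,\varphi_n(z).$$ If $S\subset L^2_\mu$ is a closed subspace and $Q$ is a (not necessarily orthogonal) linear projection of $L^2_\mu$ onto $S$, the operator $U^\mu[Q]:=QU^\mu|_S$ on $S$ is called a truncation of $U^\mu$ on $S$.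 Let $m\in\mathbb Z$ and $n\ge 1$. (a) For every $u\in\mathbb T$ there is a bounded projection $Q_{m,n}^\mu(u)$ on $\mathbb P_{m,n}$ along the orthogonal sum $\operatorname{span}\{z^mp_n^u\}\oplus\mathbb P_{m,n+1}^\perp$. It satisfies $$\|Q_{m,n}^\mu(u)\|=\sqrt{1+|u-a_n|^2/\rho_n^2},$$ and the truncation $U_{m,n}^\mu(u):=U^\mu[Q_{m,n}^\mu(u)]$ on $\mathbb P_{m,n}$ is unitary. The map $u\mapsto U_{m,n}^\mu(u)$ is a bijection from $\mathbb T$ onto the set of all unitary truncations of $U^\mu$ on $\mathbb P_{m,n}$; if $n\ge 3$, it is a bijection from $\mathbb T$ onto the set of all normal truncations of $U^\mu$ on $\mathbb P_{m,n}$ (so these are all unitary). The spectrum of $U_{m,n}^\mu(u)$ is simple (it consists of $n$ distinct eigenvalues of algebraic multiplicity one) and coincides with the set of zeros of $p_n^u$. (b) For every $u\in\mathbb T$ there is a bounded projection $Q_{m,n}^\mu(u)$ on $\mathbb P_{m,n}^\perp$ along the orthogonal sum $\operatorname{span}\{z^mq_n^u\}\oplus\mathbb P_{m+1,n-1}$.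 It satisfies $$\|Q_{m,n}^\mu(u)\|=\sqrt{1+|u-a_n|^2/\rho_n^2},$$ and the truncation $U_{m,n}^\mu(u):=U^\mu[Q_{m,n}^\mu(u)]$ on $\mathbb P_{m,n}^\perp$ is unitary. The map $u\mapsto U_{m,n}^\mu(u)$ is a bijection from $\mathbb T$ onto the set of all bounded normal truncations of $U^\mu$ on $\mathbb P_{m,n}^\perp$ (so these are all unitary). -/

import Mathlib

open MeasureTheory

namespace OPUC

/-! ## Projections and truncations in a Hilbert space -/

section Truncations

variable {H : Type*} [NormedAddCommGroup H] [InnerProductSpace ℂ H]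

/-- `Q` is the (not necessarily orthogonal) projection on `S` along `S'`. -/
def IsProjAlong (Q : H →ₗ[ℂ] H) (S S' : Submodule ℂ H) : Prop :=
  LinearMap.IsProj S Q ∧ LinearMap.ker Q = S'

/-- The truncation `T[Q] = Q T|_S`, an operator on `S`, where `Q` is a projection on `S`. -/
def truncation (T : H →L[ℂ] H) {S : Submodule ℂ H} {Q : H →ₗ[ℂ] H}
    (hQ : LinearMap.IsProj S Q) : S →ₗ[ℂ] S :=
  hQ.codRestrict ∘ₗ (T : H →ₗ[ℂ] H) ∘ₗ S.subtype

/-- The bounded operator `A` on `S` is the truncation `T[Q]` of `T` for the projection `Q` on `S`. -/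
def IsTruncationFor (T : H →L[ℂ] H) (S : Submodule ℂ H) (Q : H →ₗ[ℂ] H) (A : S →L[ℂ] S) : Prop :=
  ∃ hQ : LinearMap.IsProj S Q, (A : S →ₗ[ℂ] S) = truncation T hQ

/-- The bounded operator `A` on `S` is a truncation of `T` on `S`, that is, `A = T[Q]` for some
linear projection `Q` on `S` (along some complement of `S`; `Q` need not be bounded). -/
def IsTruncationOn (T : H →L[ℂ] H) (S : Submodule ℂ H) (A : S →L[ℂ] S) : Prop :=
  ∃ Q : H →ₗ[ℂ] H, IsTruncationFor T S Q A

end Truncations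

/-! ## The space `L²_μ` of a measure on the unit circle -/

/-- The unit circle carries its Borel σ-algebra. -/
noncomputable instance instMeasurableSpaceCircle : MeasurableSpace Circle := borel Circle

instance instBorelSpaceCircle : BorelSpace Circle := ⟨rfl⟩

section Measures

variable (μ : Measure Circle)

/-- The Hilbert space `L²_μ`. -/
abbrev L2 : Type := Lp ℂ 2 μ

theorem memLp_mul_coe (f : L2 μ) : MemLp (fun z : Circle => (z : ℂ) * f z) 2 μ := by
  refine (Lp.memLp f).of_le ?_ (Filter.Eventually.of_forall fun z => by
    rw [norm_mul, Circle.norm_coe, one_mul])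
  have hc : Continuous (fun z : Circle => (z : ℂ)) := by fun_prop
  exact hc.aestronglyMeasurable.mul (Lp.aestronglyMeasurable f)

/-- The unitary multiplication operator `U^μ f(z) = z f(z)` on `L²_μ`. -/
noncomputable def mulOp : L2 μ →L[ℂ] L2 μ :=
  LinearMap.mkContinuous
    { toFun := fun f => (memLp_mul_coe μ f).toLp
      map_add' := fun f g => by
        rw [← MemLp.toLp_add]
        refine (MemLp.toLp_eq_toLp_iff _ _).2 ?_
        filter_upwards [Lp.coeFn_add f g] with z hz
        rw [hz, Pi.add_apply, Pi.add_apply, mul_add]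
      map_smul' := fun c f => by
        rw [RingHom.id_apply, ← MemLp.toLp_const_smul]
        refine (MemLp.toLp_eq_toLp_iff _ _).2 ?_
        filter_upwards [Lp.coeFn_smul c f] with z hz
        rw [hz, Pi.smul_apply, Pi.smul_apply, smul_eq_mul, smul_eq_mul, mul_left_comm] }
    1 (fun f => by
      rw [one_mul]
      refine Lp.norm_le_norm_of_ae_le ?_
      filter_upwards [(memLp_mul_coe μ f).coeFn_toLp] with z hz
      simp only [LinearMap.coe_mk, AddHom.coe_mk]
      rw [hz, norm_mul, Circle.norm_coe, one_mul])

variable [IsFiniteMeasure μ]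

/-- The function `z ↦ z ^ m * p(z)` on the unit circle, as an element of `L²_μ`
(`m` an integer, `p` a polynomial). -/
noncomputable def laurentVec (m : ℤ) (p : Polynomial ℂ) : L2 μ :=
  ContinuousMap.toLp 2 μ ℂ
    ⟨fun z : Circle => ((z ^ m : Circle) : ℂ) * p.eval (z : ℂ), by
      simp only [Circle.coe_zpow]
      exact (Continuous.zpow₀ (by fun_prop) m fun z => Or.inl z.coe_ne_zero).mul (by fun_prop)⟩

/-- `P_{m,n} = span {z^m, z^{m+1}, …, z^{m+n-1}}` as a subspace of `L²_μ`. -/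
noncomputable def laurentSpan (m : ℤ) (n : ℕ) : Submodule ℂ (L2 μ) :=
  Submodule.span ℂ (Set.range fun k : Fin n => laurentVec μ (m + (k : ℕ)) 1)

instance instFiniteDimensionalLaurentSpan (m : ℤ) (n : ℕ) :
    FiniteDimensional ℂ (laurentSpan μ m n) :=
  FiniteDimensional.span_of_finite ℂ (Set.finite_range _)

instance instCompleteSpaceLaurentSpan (m : ℤ) (n : ℕ) : CompleteSpace (laurentSpan μ m n) :=
  FiniteDimensional.complete ℂ _

/-! ## Orthonormal and para-orthogonal polynomials, Schur parameters -/

/-- The orthonormal polynomials `φ_n` (with positive leading coefficient) of `μ`, obtained by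
orthonormalizing `1, z, z², …` in `L²_μ`. -/
noncomputable def orthoPoly (n : ℕ) : Polynomial ℂ :=
  let Φ : Polynomial ℂ := Polynomial.X ^ n - ∑ k : Fin n,
    Polynomial.C (inner ℂ (laurentVec μ 0 (orthoPoly k)) (laurentVec μ 0 (Polynomial.X ^ n)))
      * orthoPoly k
  Polynomial.C (((‖laurentVec μ 0 Φ‖⁻¹ : ℝ)) : ℂ) * Φ
termination_by n
decreasing_by all_goals exact k.2

/-- The reversed polynomial `p^*(z) = z^n * conj (p (1 / conj z))` of a polynomial of degree `n`. -/
noncomputable def revPoly (n : ℕ) (p : Polynomial ℂ) : Polynomial ℂ :=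
  (p.map (starRingEnd ℂ)).reflect n

/-- The Schur parameters `a_n`, `n ≥ 1`: the value at `0` of the monic orthogonal polynomial
of degree `n`. -/
noncomputable def schurParam (n : ℕ) : ℂ :=
  (orthoPoly μ n).eval 0 / (orthoPoly μ n).leadingCoeff

/-- `ρ_n = √(1 - |a_n|²)`. -/
noncomputable def rho (n : ℕ) : ℝ := Real.sqrt (1 - ‖schurParam μ n‖ ^ 2)

/-- `p_n^u(z) = z φ_{n-1}(z) + u φ_{n-1}^*(z)`, for `n ≥ 1`. -/
noncomputable def paraP (n : ℕ) (u : ℂ) : Polynomial ℂ :=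
  Polynomial.X * orthoPoly μ (n - 1) + Polynomial.C u * revPoly (n - 1) (orthoPoly μ (n - 1))

/-- `q_n^u(z) = φ_n^*(z) - conj u * φ_n(z)`. -/
noncomputable def paraQ (n : ℕ) (u : ℂ) : Polynomial ℂ :=
  revPoly n (orthoPoly μ n) - Polynomial.C (starRingEnd ℂ u) * orthoPoly μ n

end Measures

end OPUC

/-!
Both families of truncations are instances of one picture.  Let `U` be an isometry and `S` a closed
subspace such that `U` maps `{x ∈ S | x ⟂ e}` onto `{y ∈ S | y ⟂ f}` for unit vectors `e, f ∈ S`,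
and `U e = ρ g - α f` with a unit vector `g ⟂ S` and `ρ > 0` (`IsDefectData`).  A truncation of `U`
on `S` must agree with `U` on `S ∩ eᗮ`, so it is determined by the image of `e`, and it is unitary
only if `e` goes to `-w f` with `|w| = 1` (`IsDefectData.exists_eq_skewTrunc`).  The projection that
produces this value is the orthogonal projection on `S` plus the rank-one operator sending `g` to
`((α - w) / ρ) f` (`skewProj`); its kernel is `span {U e + w f} ⊔ (S ⊔ span {g})ᗮ` and its norm
is `√(1 + |w - α|² / ρ²)`.

For a normal truncation `A`, the self-adjoint operator `D = A†A - 1` commutes with `A`, and its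
compression to `S ∩ eᗮ` vanishes.  Either `D = 0` and `A` is unitary, or `ker D`, of codimension at
most two in `S`, is mapped by `U` onto itself (`IsDefectData.mem_unitary_or_exists_reducing`).  The
second case is impossible for multiplication by `z`: on `P_{m,n}` with `n ≥ 3` because degrees grow,
and on `P_{m,n}ᗮ` because `ker D` would be orthogonal to every `z^{m+k}`, `k ≥ 0`, and would yet
contain a nonzero combination of them.

The Szegő recursion `ρ_n φ_n = z φ_{n-1} + a_n φ_{n-1}^*` (`szego_recursion`) and its companion
`φ_n^* = ρ_n φ_{n-1}^* + conj a_n φ_n` supply the data: on `P_{m,n}` they are `e = z^m φ_{n-1}`,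
`f = z^m φ_{n-1}^*`, `g = z^m φ_n`, `α = a_n`, `w = u`, and on `P_{m,n}ᗮ` they are
`e = z^{m-1} φ_n^*`, `f = z^m φ_n`, `g = z^m φ_{n-1}^*`, `α = -conj a_n`, `w = -conj u`.

Finally, the truncation on `P_{m,n}` is multiplication by `z` modulo `p_n^u`
(`skewTrunc_laurentVec_eq_iff`), so that its eigenvalues are the zeros of `p_n^u`, with
one-dimensional eigenspaces; normality excludes generalized eigenvectors and hence multiple zeros.
-/

namespace OPUC

open scoped InnerProductSpace
open Polynomial

/-! ### Truncations of an isometry with one-dimensional defect -/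

section Abstract

variable {H : Type*} [NormedAddCommGroup H] [InnerProductSpace ℂ H]

/-- The geometry shared by the two families of truncations.  `U` is an isometry and `S` a subspace
that `U` moves by one dimension only: it maps the orthogonal complement of the unit vector `e`
in `S` onto the orthogonal complement of the unit vector `f` in `S`, and `U e = ρ g - α f`
leaves `S` in the direction of the unit vector `g`, orthogonal to `S`. -/
structure IsDefectData (U : H →L[ℂ] H) (S : Submodule ℂ H) (e f g : H) (ρ : ℝ) (α : ℂ) : Prop where
  norm_map : ∀ x, ‖U x‖ = ‖x‖
  e_mem : e ∈ S
  norm_e : ‖e‖ = 1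
  f_mem : f ∈ S
  norm_f : ‖f‖ = 1
  g_mem : g ∈ Sᗮ
  norm_g : ‖g‖ = 1
  rho_pos : 0 < ρ
  map_e : U e = (ρ : ℂ) • g - α • f
  map_mem : ∀ x ∈ S, ⟪e, x⟫_ℂ = 0 → U x ∈ S
  inner_map : ∀ x ∈ S, ⟪e, x⟫_ℂ = 0 → ⟪f, U x⟫_ℂ = 0
  exists_map_eq : ∀ y ∈ S, ⟪f, y⟫_ℂ = 0 → ∃ x ∈ S, ⟪e, x⟫_ℂ = 0 ∧ U x = y

/-- The orthogonal projection on `S` plus a rank-one operator sending `g` to a multiple of `f`.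
For data as in `IsDefectData` it is the projection on `S` along
`span {U e + w f} ⊔ (S ⊔ span {g})ᗮ`. -/
noncomputable def skewProj (S : Submodule ℂ H) [S.HasOrthogonalProjection] (f g : H) (ρ : ℝ)
    (α w : ℂ) : H →L[ℂ] H :=
  S.starProjection + (innerSL ℂ g).smulRight (((α - w) / ρ) • f)

theorem skewProj_apply (S : Submodule ℂ H) [S.HasOrthogonalProjection] (f g : H) (ρ : ℝ)
    (α w : ℂ) (x : H) :
    skewProj S f g ρ α w x = S.starProjection x + ⟪g, x⟫_ℂ • ((α - w) / ρ) • f := by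
  simp [skewProj]

/-- A truncation of `T` on `S` acts as `T` wherever `T` stays in `S`. -/
theorem IsTruncationOn.apply_eq {T : H →L[ℂ] H} {S : Submodule ℂ H} {A : S →L[ℂ] S}
    (hA : IsTruncationOn T S A) (x : S) (hx : T x ∈ S) : (A x : H) = T x := by
  obtain ⟨Q, hQ, hAQ⟩ := hA
  have h := LinearMap.congr_fun hAQ x
  have h2 : (A x : H) = Q (T x) := congrArg Subtype.val h
  rw [h2, hQ.map_id _ hx]

namespace IsDefectData

variable {U : H →L[ℂ] H} {S : Submodule ℂ H} {e f g : H} {ρ : ℝ} {α : ℂ}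

theorem ofReal_rho_ne_zero (h : IsDefectData U S e f g ρ α) : (ρ : ℂ) ≠ 0 :=
  Complex.ofReal_ne_zero.2 h.rho_pos.ne'

theorem inner_g (h : IsDefectData U S e f g ρ α) {x : H} (hx : x ∈ S) : ⟪g, x⟫_ℂ = 0 :=
  (Submodule.mem_orthogonal' _ _).1 h.g_mem x hx

/-- Splitting off the component along `e`. -/
theorem exists_decomp (h : IsDefectData U S e f g ρ α) {x : H} (hx : x ∈ S) :
    ∃ y ∈ S, ⟪e, y⟫_ℂ = 0 ∧ x = y + ⟪e, x⟫_ℂ • e := by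
  refine ⟨x - ⟪e, x⟫_ℂ • e, S.sub_mem hx (S.smul_mem _ h.e_mem), ?_, by simp⟩
  rw [inner_sub_right, inner_smul_right, inner_self_eq_norm_sq_to_K, h.norm_e]
  simp

theorem span_isOrtho (h : IsDefectData U S e f g ρ α) (w : ℂ) :
    Submodule.span ℂ {U e + w • f} ⟂ (S ⊔ Submodule.span ℂ {g})ᗮ := by
  rw [Submodule.isOrtho_iff_le]
  refine le_trans ?_ (Submodule.le_orthogonal_orthogonal _)
  rw [Submodule.span_singleton_le_iff_mem, h.map_e]
  have hf := Submodule.mem_sup_left (T := Submodule.span ℂ {g}) h.f_mem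
  have hg := Submodule.mem_sup_right (S := S) (Submodule.mem_span_singleton_self (R := ℂ) g)
  exact Submodule.add_mem _ (Submodule.sub_mem _ (Submodule.smul_mem _ _ hg)
    (Submodule.smul_mem _ _ hf)) (Submodule.smul_mem _ _ hf)

section Projection

variable [S.HasOrthogonalProjection]

theorem skewProj_mem (h : IsDefectData U S e f g ρ α) (w : ℂ) (x : H) :
    skewProj S f g ρ α w x ∈ S := by
  rw [skewProj_apply]
  exact S.add_mem (S.starProjection_apply_mem x)
    (S.smul_mem _ (S.smul_mem _ h.f_mem))

theorem skewProj_of_mem (h : IsDefectData U S e f g ρ α) (w : ℂ) {x : H} (hx : x ∈ S) :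
    skewProj S f g ρ α w x = x := by
  rw [skewProj_apply, Submodule.starProjection_eq_self_iff.2 hx, h.inner_g hx]
  simp

theorem isProj_skewProj (h : IsDefectData U S e f g ρ α) (w : ℂ) :
    LinearMap.IsProj S (skewProj S f g ρ α w : H →ₗ[ℂ] H) :=
  ⟨fun x => h.skewProj_mem w x, fun _ hx => h.skewProj_of_mem w hx⟩

theorem skewProj_g (h : IsDefectData U S e f g ρ α) (w : ℂ) :
    skewProj S f g ρ α w g = ((α - w) / ρ) • f := by
  rw [skewProj_apply, (S.starProjection_apply_eq_zero_iff).2 h.g_mem,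
    inner_self_eq_norm_sq_to_K, h.norm_g]
  simp

theorem skewProj_map_e (h : IsDefectData U S e f g ρ α) (w : ℂ) :
    skewProj S f g ρ α w (U e) = -w • f := by
  have := h.ofReal_rho_ne_zero
  rw [h.map_e, map_sub, map_smul, map_smul, h.skewProj_g, h.skewProj_of_mem w h.f_mem, smul_smul,
    ← sub_smul]
  congr 1
  field_simp
  ring

theorem mem_ker_skewProj_iff (h : IsDefectData U S e f g ρ α) (w : ℂ) {x : H} :
    skewProj S f g ρ α w x = 0 ↔
      x ∈ Submodule.span ℂ {U e + w • f} ⊔ (S ⊔ Submodule.span ℂ {g})ᗮ := by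
  have hρ := h.ofReal_rho_ne_zero
  constructor
  · intro hx
    have key : x - (⟪g, x⟫_ℂ / ρ) • (U e + w • f) ∈ (S ⊔ Submodule.span ℂ {g})ᗮ := by
      rw [← Submodule.inf_orthogonal]
      refine ⟨?_, ?_⟩
      · -- the orthogonal projection of the difference on `S` is the skew projection of `x`
        rw [SetLike.mem_coe, ← Submodule.starProjection_apply_eq_zero_iff, ← hx, skewProj_apply,
          map_sub, map_smul, map_add, h.map_e, map_sub, map_smul,
          map_smul, map_smul, (S.starProjection_apply_eq_zero_iff).2 h.g_mem,
          Submodule.starProjection_eq_self_iff.2 h.f_mem]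
        module
      · rw [SetLike.mem_coe, Submodule.mem_orthogonal_singleton_iff_inner_right, h.map_e]
        simp only [inner_sub_right, inner_add_right, inner_smul_right, h.inner_g h.f_mem,
          inner_self_eq_norm_sq_to_K, h.norm_g]
        simp [hρ]
    rw [← add_sub_cancel ((⟪g, x⟫_ℂ / ρ) • (U e + w • f)) x]
    exact Submodule.add_mem_sup (Submodule.smul_mem _ _ (Submodule.mem_span_singleton_self _)) key
  · intro hx
    obtain ⟨y, hy, z, hz, rfl⟩ := Submodule.mem_sup.1 hx
    obtain ⟨c, rfl⟩ := Submodule.mem_span_singleton.1 hy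
    rw [← Submodule.inf_orthogonal] at hz
    have hz1 : skewProj S f g ρ α w z = 0 := by
      rw [skewProj_apply, (S.starProjection_apply_eq_zero_iff).2 hz.1,
        Submodule.mem_orthogonal_singleton_iff_inner_right.1 hz.2]
      simp
    rw [map_add, map_smul, map_add, map_smul, h.skewProj_map_e, h.skewProj_of_mem w h.f_mem, hz1]
    simp

theorem isProjAlong_skewProj (h : IsDefectData U S e f g ρ α) (w : ℂ) :
    IsProjAlong (skewProj S f g ρ α w : H →ₗ[ℂ] H) S
      (Submodule.span ℂ {U e + w • f} ⊔ (S ⊔ Submodule.span ℂ {g})ᗮ) := by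
  refine ⟨h.isProj_skewProj w, ?_⟩
  ext x
  rw [LinearMap.mem_ker]
  exact h.mem_ker_skewProj_iff w

theorem norm_skewProj (h : IsDefectData U S e f g ρ α) (w : ℂ) :
    ‖skewProj S f g ρ α w‖ = Real.sqrt (1 + ‖w - α‖ ^ 2 / ρ ^ 2) := by
  set k : ℂ := (α - w) / ρ with hk
  have hkn : ‖w - α‖ ^ 2 / ρ ^ 2 = ‖k‖ ^ 2 := by
    rw [hk, norm_div, div_pow, norm_sub_rev, Complex.norm_real, Real.norm_eq_abs, sq_abs]
  rw [hkn]
  refine ContinuousLinearMap.opNorm_eq_of_bounds (Real.sqrt_nonneg _) (fun x => ?_) ?_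
  · -- Bessel's inequality for `S` and `g`, then Cauchy-Schwarz in the plane
    set p := S.starProjection x with hp
    set c := ⟪g, x⟫_ℂ with hc
    have hpS : p ∈ S := S.starProjection_apply_mem x
    have hx : ‖x‖ ^ 2 = ‖p‖ ^ 2 + ‖x - p‖ ^ 2 := by
      have h0 : ⟪p, x - p⟫_ℂ = 0 :=
        (Submodule.mem_orthogonal _ _).1 (S.sub_starProjection_mem_orthogonal x) p hpS
      have := norm_add_sq_eq_norm_sq_add_norm_sq_of_inner_eq_zero p (x - p) h0
      rw [add_sub_cancel] at this
      simpa [sq] using this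
    have hcle : ‖c‖ ≤ ‖x - p‖ := by
      have h1 : c = ⟪g, x - p⟫_ℂ := by rw [inner_sub_right, h.inner_g hpS, sub_zero]
      rw [h1]
      simpa only [h.norm_g, one_mul] using norm_inner_le_norm (𝕜 := ℂ) g (x - p)
    have hQ : ‖skewProj S f g ρ α w x‖ ≤ ‖p‖ + ‖c‖ * ‖k‖ := by
      rw [skewProj_apply]
      refine (norm_add_le _ _).trans ?_
      rw [norm_smul, norm_smul, h.norm_f, mul_one]
    refine hQ.trans ?_
    refine abs_le_of_sq_le_sq' ?_ (by positivity) |>.2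
    rw [mul_pow, Real.sq_sqrt (by positivity), hx]
    have hc2 : ‖c‖ ^ 2 ≤ ‖x - p‖ ^ 2 := by gcongr
    nlinarith [sq_nonneg (‖k‖ * ‖p‖ - ‖c‖), mul_le_mul_of_nonneg_left hc2
      (by positivity : 0 ≤ 1 + ‖k‖ ^ 2)]
  · intro N hN hle
    -- the norm is attained at `f + conj k • g`
    have hv := hle (f + (starRingEnd ℂ k) • g)
    have hQv : skewProj S f g ρ α w (f + (starRingEnd ℂ k) • g) = ((1 + ‖k‖ ^ 2 : ℝ) : ℂ) • f := by
      rw [map_add, map_smul, h.skewProj_of_mem w h.f_mem, h.skewProj_g, smul_smul, ← hk,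
        mul_comm (starRingEnd ℂ k), Complex.mul_conj']
      push_cast
      rw [add_smul, one_smul]
    have hvn : ‖f + (starRingEnd ℂ k) • g‖ ^ 2 = 1 + ‖k‖ ^ 2 := by
      have h0 : ⟪f, (starRingEnd ℂ k) • g⟫_ℂ = 0 := by
        rw [inner_smul_right, (Submodule.mem_orthogonal _ _).1 h.g_mem f h.f_mem, mul_zero]
      have := norm_add_sq_eq_norm_sq_add_norm_sq_of_inner_eq_zero _ _ h0
      rw [sq, this, norm_smul, h.norm_f, h.norm_g, RCLike.norm_conj]
      ring
    rw [hQv, norm_smul, h.norm_f, mul_one, Complex.norm_real, Real.norm_of_nonneg (by positivity),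
      ← Real.sqrt_sq (norm_nonneg (f + _)), hvn] at hv
    have hpos : 0 < Real.sqrt (1 + ‖k‖ ^ 2) := Real.sqrt_pos.2 (by positivity)
    refine le_of_mul_le_mul_right ?_ hpos
    rwa [Real.mul_self_sqrt (by positivity)]

/-- The truncation of `U` on `S` for the projection `skewProj`. -/
noncomputable def skewTrunc (h : IsDefectData U S e f g ρ α) (w : ℂ) : S →L[ℂ] S :=
  ((skewProj S f g ρ α w ∘L U) ∘L S.subtypeL).codRestrict S fun x => h.skewProj_mem w (U x)

theorem skewTrunc_apply (h : IsDefectData U S e f g ρ α) (w : ℂ) (x : S) :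
    (h.skewTrunc w x : H) = skewProj S f g ρ α w (U x) := rfl

theorem isTruncationFor_skewTrunc (h : IsDefectData U S e f g ρ α) (w : ℂ) :
    IsTruncationFor U S (skewProj S f g ρ α w : H →ₗ[ℂ] H) (h.skewTrunc w) :=
  ⟨h.isProj_skewProj w, rfl⟩

theorem isTruncationOn_skewTrunc (h : IsDefectData U S e f g ρ α) (w : ℂ) :
    IsTruncationOn U S (h.skewTrunc w) :=
  ⟨_, h.isTruncationFor_skewTrunc w⟩

theorem skewTrunc_e (h : IsDefectData U S e f g ρ α) (w : ℂ) :
    h.skewTrunc w ⟨e, h.e_mem⟩ = -w • ⟨f, h.f_mem⟩ :=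
  Subtype.ext (h.skewProj_map_e w)

theorem skewTrunc_injective (h : IsDefectData U S e f g ρ α) : Function.Injective h.skewTrunc := by
  intro w w' hww
  have h1 := h.skewTrunc_e w
  rw [hww, h.skewTrunc_e w'] at h1
  have hf : (⟨f, h.f_mem⟩ : S) ≠ 0 := by
    intro h0
    have : f = 0 := congrArg Subtype.val h0
    simpa [this] using h.norm_f
  exact (neg_injective (smul_left_injective ℂ hf h1)).symm

end Projection

theorem inner_map_map (h : IsDefectData U S e f g ρ α) (x y : H) :
    ⟪U x, U y⟫_ℂ = ⟪x, y⟫_ℂ :=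
  LinearIsometry.inner_map_map ⟨(U : H →ₗ[ℂ] H), h.norm_map⟩ x y

/-- A truncation is determined by its value at `e`. -/
theorem truncation_ext (h : IsDefectData U S e f g ρ α) {A B : S →L[ℂ] S}
    (hA : IsTruncationOn U S A) (hB : IsTruncationOn U S B)
    (hAB : A ⟨e, h.e_mem⟩ = B ⟨e, h.e_mem⟩) : A = B := by
  ext ⟨x, hx⟩
  obtain ⟨y, hy, hey, hxy⟩ := h.exists_decomp hx
  have hxe : (⟨x, hx⟩ : S) = ⟨y, hy⟩ + ⟪e, x⟫_ℂ • ⟨e, h.e_mem⟩ := Subtype.ext hxy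
  have hUy := h.map_mem y hy hey
  rw [hxe, map_add, map_add, map_smul, map_smul, hAB, Submodule.coe_add, Submodule.coe_add,
    hA.apply_eq ⟨y, hy⟩ hUy, hB.apply_eq ⟨y, hy⟩ hUy]

variable [CompleteSpace S]

theorem skewTrunc_mem_unitary (h : IsDefectData U S e f g ρ α) {w : ℂ} (hw : ‖w‖ = 1) :
    h.skewTrunc w ∈ unitary (S →L[ℂ] S) := by
  have happ : ∀ y (hy : y ∈ S) (_ : ⟪e, y⟫_ℂ = 0), (h.skewTrunc w ⟨y, hy⟩ : H) = U y :=
    fun y hy hey => (h.isTruncationOn_skewTrunc w).apply_eq ⟨y, hy⟩ (h.map_mem y hy hey)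
  have hw0 : w ≠ 0 := by rintro rfl; simp at hw
  have hiso : star (h.skewTrunc w) * h.skewTrunc w = 1 := by
    refine (ContinuousLinearMap.norm_map_iff_adjoint_comp_self _).1 ?_
    rintro ⟨x, hx⟩
    obtain ⟨y, hy, hey, hxy⟩ := h.exists_decomp hx
    set c := ⟪e, x⟫_ℂ
    have hxe : (⟨x, hx⟩ : S) = ⟨y, hy⟩ + c • ⟨e, h.e_mem⟩ := Subtype.ext hxy
    have h1 : (h.skewTrunc w ⟨x, hx⟩ : H) = U y + (c * -w) • f := by
      rw [hxe, map_add, map_smul, h.skewTrunc_e, Submodule.coe_add, happ y hy hey, smul_smul]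
      rfl
    have h2 : ‖U y + (c * -w) • f‖ * ‖U y + (c * -w) • f‖ = ‖x‖ * ‖x‖ := by
      rw [norm_add_sq_eq_norm_sq_add_norm_sq_of_inner_eq_zero (𝕜 := ℂ), hxy,
        norm_add_sq_eq_norm_sq_add_norm_sq_of_inner_eq_zero (𝕜 := ℂ), h.norm_map, norm_smul,
        norm_smul, norm_mul, norm_neg, hw, h.norm_f, h.norm_e, mul_one]
      · rw [inner_smul_right, inner_eq_zero_symm.1 hey, mul_zero]
      · rw [inner_smul_right, inner_eq_zero_symm.1 (h.inner_map y hy hey), mul_zero]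
    rw [Submodule.coe_norm, h1]
    exact (mul_self_inj (norm_nonneg _) (norm_nonneg _)).1 h2
  refine Unitary.mem_iff.2 ⟨hiso, ?_⟩
  have hsurj : Function.Surjective (h.skewTrunc w) := by
    rintro ⟨y, hy⟩
    have hfy : ⟪f, y - ⟪f, y⟫_ℂ • f⟫_ℂ = 0 := by
      rw [inner_sub_right, inner_smul_right, inner_self_eq_norm_sq_to_K, h.norm_f]
      simp
    obtain ⟨x, hx, hex, hUx⟩ :=
      h.exists_map_eq _ (S.sub_mem hy (S.smul_mem ⟪f, y⟫_ℂ h.f_mem)) hfy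
    refine ⟨⟨x, hx⟩ + (-⟪f, y⟫_ℂ / w) • ⟨e, h.e_mem⟩, Subtype.ext ?_⟩
    rw [map_add, map_smul, h.skewTrunc_e, smul_smul, Submodule.coe_add, happ x hx hex, hUx,
      show -⟪f, y⟫_ℂ / w * -w = ⟪f, y⟫_ℂ by field_simp]
    simp
  ext1 y
  obtain ⟨x, rfl⟩ := hsurj y
  have := congrArg (h.skewTrunc w) (congrArg (fun B : S →L[ℂ] S => B x) hiso)
  simpa using this

theorem isStarNormal_skewTrunc (h : IsDefectData U S e f g ρ α) {w : ℂ} (hw : ‖w‖ = 1) :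
    IsStarNormal (h.skewTrunc w) := by
  have hu := Unitary.mem_iff.1 (h.skewTrunc_mem_unitary hw)
  exact ⟨hu.1.trans hu.2.symm⟩

/-- A unitary truncation maps the orthogonal complement of `e` onto that of `f`, so it has no
choice but to send `e` to a unimodular multiple of `f`. -/
theorem exists_eq_skewTrunc (h : IsDefectData U S e f g ρ α) {A : S →L[ℂ] S}
    (hA : IsTruncationOn U S A) (hu : A ∈ unitary (S →L[ℂ] S)) :
    ∃ w : ℂ, ‖w‖ = 1 ∧ h.skewTrunc w = A := by
  have hin : ∀ x y, ⟪A x, A y⟫_ℂ = ⟪x, y⟫_ℂ :=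
    (ContinuousLinearMap.inner_map_map_iff_adjoint_comp_self A).2 (Unitary.mem_iff.1 hu).1
  have hnorm : ∀ x, ‖A x‖ = ‖x‖ :=
    (ContinuousLinearMap.norm_map_iff_adjoint_comp_self A).2 (Unitary.mem_iff.1 hu).1
  set v : H := ((A ⟨e, h.e_mem⟩ : S) : H) with hv
  have hvS : v ∈ S := (A ⟨e, h.e_mem⟩).2
  have hvn : ‖v‖ = 1 := by
    rw [hv, ← Submodule.coe_norm, hnorm]; exact h.norm_e
  have hr : v - ⟪f, v⟫_ℂ • f ∈ S := S.sub_mem hvS (S.smul_mem _ h.f_mem)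
  have hfr : ⟪f, v - ⟪f, v⟫_ℂ • f⟫_ℂ = 0 := by
    rw [inner_sub_right, inner_smul_right, inner_self_eq_norm_sq_to_K, h.norm_f]
    simp
  obtain ⟨x, hx, hex, hUx⟩ := h.exists_map_eq _ hr hfr
  have hAx : (A ⟨x, hx⟩ : H) = U x := hA.apply_eq ⟨x, hx⟩ (h.map_mem x hx hex)
  have h0 : ⟪v - ⟪f, v⟫_ℂ • f, v⟫_ℂ = 0 := by
    have := hin ⟨x, hx⟩ ⟨e, h.e_mem⟩
    rw [Submodule.coe_inner, Submodule.coe_inner, hAx, hUx, inner_eq_zero_symm.1 hex] at this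
    exact this
  have hvf : v = ⟪f, v⟫_ℂ • f := by
    rw [← sub_eq_zero, ← inner_self_eq_zero (𝕜 := ℂ)]
    rw [inner_sub_right (v - ⟪f, v⟫_ℂ • f) v, h0, inner_smul_right, inner_eq_zero_symm.1 hfr]
    simp
  refine ⟨-⟪f, v⟫_ℂ, ?_, ?_⟩
  · rw [hvf, norm_smul, h.norm_f, mul_one] at hvn
    rwa [norm_neg]
  · refine h.truncation_ext (h.isTruncationOn_skewTrunc _) hA ?_
    rw [h.skewTrunc_e, neg_neg]
    exact Subtype.ext hvf.symm

/-- The defect `D = A†A - 1` of a normal truncation commutes with `A` and has vanishing compression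
to the orthogonal complement of `e`.  If `ker D` contains a vector that is not orthogonal to `e`,
then `D = 0`.  Otherwise `ker D`, which is cut out of `S` by the two vectors `e` and `D e`, is
mapped by `U` onto itself. -/
theorem mem_unitary_or_exists_reducing (h : IsDefectData U S e f g ρ α) {A : S →L[ℂ] S}
    (hA : IsTruncationOn U S A) (hn : IsStarNormal A) :
    A ∈ unitary (S →L[ℂ] S) ∨ ∃ d ∈ S,
      (∀ x ∈ S, ⟪e, x⟫_ℂ = 0 → ⟪d, x⟫_ℂ = 0 →
        U x ∈ S ∧ ⟪e, U x⟫_ℂ = 0 ∧ ⟪d, U x⟫_ℂ = 0) ∧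
      (∀ y ∈ S, ⟪e, y⟫_ℂ = 0 → ⟪d, y⟫_ℂ = 0 →
        ∃ x ∈ S, (⟪e, x⟫_ℂ = 0 ∧ ⟪d, x⟫_ℂ = 0) ∧ U x = y) := by
  have hcomm : star A * A = A * star A := hn.star_comm_self
  set D : S →L[ℂ] S := star A * A - 1 with hD
  set e' : S := ⟨e, h.e_mem⟩ with he'
  have hDsa : ∀ x y, ⟪D x, y⟫_ℂ = ⟪x, D y⟫_ℂ := by
    intro x y
    simp only [hD, sub_apply, mul_apply_eq_comp,
      one_apply_eq_self, inner_sub_left, inner_sub_right,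
      ContinuousLinearMap.star_eq_adjoint, ContinuousLinearMap.adjoint_inner_left,
      ContinuousLinearMap.adjoint_inner_right]
  have hDA : ∀ x, D (A x) = A (D x) := by
    intro x
    have : D * A = A * D := by
      rw [hD, sub_mul, mul_sub, one_mul, mul_one, hcomm, mul_assoc, hcomm]
    exact congrArg (fun B : S →L[ℂ] S => B x) this
  have hDA' : ∀ x, D (star A x) = star A (D x) := by
    intro x
    have : D * star A = star A * D := by
      rw [hD, sub_mul, mul_sub, one_mul, mul_one, mul_assoc, ← hcomm]
    exact congrArg (fun B : S →L[ℂ] S => B x) this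
  have hDeq : ∀ x, star A (A x) = D x + x := by intro x; simp [hD]
  have hcompr : ∀ x y : S, ⟪e', x⟫_ℂ = 0 → ⟪e', y⟫_ℂ = 0 → ⟪y, D x⟫_ℂ = 0 := by
    intro x y hx hy
    have h1 := hA.apply_eq x (h.map_mem x x.2 hx)
    have h2 := hA.apply_eq y (h.map_mem y y.2 hy)
    have h3 : D x = star A (A x) - x := by rw [hDeq]; simp
    rw [h3, inner_sub_right, ContinuousLinearMap.star_eq_adjoint,
      ContinuousLinearMap.adjoint_inner_right, Submodule.coe_inner, Submodule.coe_inner, h1, h2,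
      h.inner_map_map, sub_self]
  have hdecomp : ∀ x : S, ∃ y : S, ⟪e', y⟫_ℂ = 0 ∧ x = y + ⟪e', x⟫_ℂ • e' := by
    rintro ⟨x, hx⟩
    obtain ⟨y, hy, hey, hxy⟩ := h.exists_decomp hx
    exact ⟨⟨y, hy⟩, hey, Subtype.ext hxy⟩
  -- a vector is zero as soon as it is orthogonal to `e` and to the complement of `e`
  have hzero : ∀ x : S, ⟪e', x⟫_ℂ = 0 → (∀ y, ⟪e', y⟫_ℂ = 0 → ⟪y, x⟫_ℂ = 0) → x = 0 :=
    fun x h1 h2 => inner_self_eq_zero.1 (h2 x h1)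
  by_cases hker : ∃ x, D x = 0 ∧ ⟪e', x⟫_ℂ ≠ 0
  · left
    obtain ⟨x, hx0, hxe⟩ := hker
    obtain ⟨y, hy, hxy⟩ := hdecomp x
    have hDe : ∀ z, ⟪e', z⟫_ℂ = 0 → ⟪z, D e'⟫_ℂ = 0 := by
      intro z hz
      have h1 : ⟪z, D x⟫_ℂ = 0 := by rw [hx0, inner_zero_right]
      rw [hxy, map_add, map_smul, inner_add_right, hcompr y z hy hz, zero_add,
        inner_smul_right] at h1
      exact (mul_eq_zero.1 h1).resolve_left hxe
    have hDM : ∀ z, ⟪e', z⟫_ℂ = 0 → D z = 0 := by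
      intro z hz
      refine hzero _ ?_ fun y hy => hcompr z y hz hy
      rw [← hDsa, inner_eq_zero_symm]
      exact hDe z hz
    have hDe0 : D e' = 0 := by
      have h1 := hx0
      rw [hxy, map_add, map_smul, hDM y hy, zero_add] at h1
      exact (smul_eq_zero.1 h1).resolve_left hxe
    have hD0 : D = 0 := by
      ext1 z
      obtain ⟨y, hy, hzy⟩ := hdecomp z
      rw [hzy, map_add, map_smul, hDM y hy, hDe0]
      simp
    have h1 : star A * A = 1 := sub_eq_zero.1 hD0
    exact Unitary.mem_iff.2 ⟨h1, hcomm ▸ h1⟩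
  · right
    push Not at hker
    have hiff : ∀ x : S, ⟪e', x⟫_ℂ = 0 → ⟪D e', x⟫_ℂ = 0 → D x = 0 := by
      intro x h1 h2
      exact hzero _ (by rw [← hDsa]; exact h2) fun y hy => hcompr x y h1 hy
    have hiff' : ∀ x : S, D x = 0 → ⟪D e', x⟫_ℂ = 0 := by
      intro x hx
      rw [hDsa, hx, inner_zero_right]
    refine ⟨D e', (D e').2, ?_, ?_⟩
    · intro x hx h1 h2
      have hx0 := hiff ⟨x, hx⟩ h1 h2
      have hAx : (A ⟨x, hx⟩ : H) = U x := hA.apply_eq ⟨x, hx⟩ (h.map_mem x hx h1)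
      have hDAx : D (A ⟨x, hx⟩) = 0 := by rw [hDA, hx0, map_zero]
      rw [← hAx]
      exact ⟨(A ⟨x, hx⟩).2, hker _ hDAx, hiff' _ hDAx⟩
    · intro y hy h1 h2
      have hy0 := hiff ⟨y, hy⟩ h1 h2
      have hDx : D (star A ⟨y, hy⟩) = 0 := by rw [hDA', hy0, map_zero]
      refine ⟨star A ⟨y, hy⟩, (star A ⟨y, hy⟩).2, ⟨hker _ hDx, hiff' _ hDx⟩, ?_⟩
      rw [← hA.apply_eq _ (h.map_mem _ (star A ⟨y, hy⟩).2 (hker _ hDx))]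
      have h3 : A (star A ⟨y, hy⟩) = ⟨y, hy⟩ := by
        have : A (star A ⟨y, hy⟩) = star A (A ⟨y, hy⟩) :=
          (congrArg (fun B : S →L[ℂ] S => B ⟨y, hy⟩) hcomm).symm
        rw [this, hDeq, hy0, zero_add]
      rw [h3]

end IsDefectData

end Abstract

/-! ### Laurent polynomials in `L²_μ` -/

section Laurent

variable (μ : Measure Circle)

theorem norm_mulOp (f : L2 μ) : ‖mulOp μ f‖ = ‖f‖ := by
  have h : (mulOp μ f : L2 μ) = (memLp_mul_coe μ f).toLp := rfl
  refine le_antisymm (Lp.norm_le_norm_of_ae_le ?_) (Lp.norm_le_norm_of_ae_le ?_) <;>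
  · rw [h]
    filter_upwards [(memLp_mul_coe μ f).coeFn_toLp] with z hz
    rw [hz, norm_mul, Circle.norm_coe, one_mul]

theorem mulOp_surjective : Function.Surjective (mulOp μ) := by
  intro f
  have hg : MemLp (fun z : Circle => ((z⁻¹ : Circle) : ℂ) * f z) 2 μ := by
    refine (Lp.memLp f).of_le ?_ (Filter.Eventually.of_forall fun z => by
      rw [norm_mul, Circle.norm_coe, one_mul])
    have hc : Continuous (fun z : Circle => ((z⁻¹ : Circle) : ℂ)) := by fun_prop
    exact hc.aestronglyMeasurable.mul (Lp.aestronglyMeasurable f)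
  refine ⟨hg.toLp, ?_⟩
  have h : (mulOp μ hg.toLp : L2 μ) = (memLp_mul_coe μ hg.toLp).toLp := rfl
  rw [h]
  refine Lp.ext ?_
  filter_upwards [(memLp_mul_coe μ hg.toLp).coeFn_toLp, hg.coeFn_toLp] with z hz hz'
  rw [hz, hz', ← mul_assoc, ← Circle.coe_mul, mul_inv_cancel, Circle.coe_one, one_mul]

variable [IsFiniteMeasure μ]

theorem coeFn_laurentVec (m : ℤ) (p : ℂ[X]) :
    laurentVec μ m p =ᵐ[μ] fun z : Circle => ((z ^ m : Circle) : ℂ) * p.eval (z : ℂ) :=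
  ContinuousMap.coeFn_toLp μ _

theorem laurentVec_congr {m m' : ℤ} {p q : ℂ[X]}
    (h : ∀ z : Circle, ((z ^ m : Circle) : ℂ) * p.eval (z : ℂ)
      = ((z ^ m' : Circle) : ℂ) * q.eval (z : ℂ)) : laurentVec μ m p = laurentVec μ m' q := by
  unfold laurentVec
  congr 1
  ext z
  exact h z

theorem laurentVec_add (m : ℤ) (p q : ℂ[X]) :
    laurentVec μ m (p + q) = laurentVec μ m p + laurentVec μ m q := by
  unfold laurentVec
  rw [← map_add]
  congr 1
  ext z
  simp [mul_add]

theorem laurentVec_smul (m : ℤ) (c : ℂ) (p : ℂ[X]) :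
    laurentVec μ m (c • p) = c • laurentVec μ m p := by
  unfold laurentVec
  rw [← map_smul]
  congr 1
  ext z
  simp [mul_left_comm]

/-- `laurentVec` as a linear map in the polynomial. -/
noncomputable def laurentHom (m : ℤ) : ℂ[X] →ₗ[ℂ] L2 μ where
  toFun := laurentVec μ m
  map_add' := laurentVec_add μ m
  map_smul' := laurentVec_smul μ m

theorem laurentVec_sub (m : ℤ) (p q : ℂ[X]) :
    laurentVec μ m (p - q) = laurentVec μ m p - laurentVec μ m q :=
  map_sub (laurentHom μ m) p q

theorem laurentVec_C_mul (m : ℤ) (c : ℂ) (p : ℂ[X]) :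
    laurentVec μ m (C c * p) = c • laurentVec μ m p := by
  rw [C_mul', laurentVec_smul]

theorem laurentVec_zero (m : ℤ) : laurentVec μ m 0 = 0 := map_zero (laurentHom μ m)

theorem laurentVec_sum (m : ℤ) {ι : Type*} (s : Finset ι) (p : ι → ℂ[X]) :
    laurentVec μ m (∑ i ∈ s, p i) = ∑ i ∈ s, laurentVec μ m (p i) :=
  map_sum (laurentHom μ m) p s

theorem laurentVec_X_mul (m : ℤ) (p : ℂ[X]) :
    laurentVec μ m (X * p) = laurentVec μ (m + 1) p := by
  refine laurentVec_congr μ fun z => ?_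
  rw [zpow_add_one, Circle.coe_mul, eval_mul, eval_X, mul_assoc]

theorem mulOp_laurentVec (m : ℤ) (p : ℂ[X]) :
    mulOp μ (laurentVec μ m p) = laurentVec μ m (X * p) := by
  have h : (mulOp μ (laurentVec μ m p) : L2 μ) = (memLp_mul_coe μ (laurentVec μ m p)).toLp := rfl
  rw [h]
  refine Lp.ext ?_
  filter_upwards [(memLp_mul_coe μ (laurentVec μ m p)).coeFn_toLp, coeFn_laurentVec μ m p,
    coeFn_laurentVec μ m (X * p)] with z h1 h2 h3
  rw [h1, h2, h3, eval_mul, eval_X, mul_left_comm]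

theorem inner_laurentVec (m : ℤ) (p q : ℂ[X]) :
    ⟪laurentVec μ m p, laurentVec μ m q⟫_ℂ
      = ∫ z : Circle, q.eval (z : ℂ) * starRingEnd ℂ (p.eval (z : ℂ)) ∂μ := by
  unfold laurentVec
  rw [ContinuousMap.inner_toLp]
  refine integral_congr_ae (Filter.Eventually.of_forall fun z => ?_)
  have hz : ((z ^ m : Circle) : ℂ) * starRingEnd ℂ ((z ^ m : Circle) : ℂ) = 1 := by
    rw [Complex.mul_conj', Circle.norm_coe]
    simp
  simp only [ContinuousMap.coe_mk, map_mul]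
  rw [mul_mul_mul_comm, hz, one_mul]

/-- Multiplication by `z ^ m` is unitary. -/
theorem inner_laurentVec_eq (m : ℤ) (p q : ℂ[X]) :
    ⟪laurentVec μ m p, laurentVec μ m q⟫_ℂ = ⟪laurentVec μ 0 p, laurentVec μ 0 q⟫_ℂ := by
  rw [inner_laurentVec, inner_laurentVec]

theorem norm_laurentVec_eq (m : ℤ) (p : ℂ[X]) :
    ‖laurentVec μ m p‖ = ‖laurentVec μ 0 p‖ := by
  rw [@norm_eq_sqrt_re_inner ℂ, @norm_eq_sqrt_re_inner ℂ, inner_laurentVec_eq]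

theorem inner_X_mul_X_mul (p q : ℂ[X]) :
    ⟪laurentVec μ 0 (X * p), laurentVec μ 0 (X * q)⟫_ℂ
      = ⟪laurentVec μ 0 p, laurentVec μ 0 q⟫_ℂ := by
  rw [laurentVec_X_mul, laurentVec_X_mul, inner_laurentVec_eq]

variable {μ} in
/-- A nonzero polynomial vanishes at finitely many points, which cannot carry a measure of infinite
support. -/
theorem eq_zero_of_laurentVec_eq_zero (hμ : μ.support.Infinite) {m : ℤ} {p : ℂ[X]}
    (h : laurentVec μ m p = 0) : p = 0 := by
  by_contra hp
  have hfin : {z : Circle | p.eval (z : ℂ) = 0}.Finite := by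
    refine Set.Finite.preimage (f := fun z : Circle => (z : ℂ)) (s := {w | p.IsRoot w})
      Circle.coe_injective.injOn (p.finite_setOfPred_isRoot hp)
  refine hμ (hfin.subset (Measure.support_subset_of_isClosed hfin.isClosed ?_))
  have h0 : (laurentVec μ m p : Circle → ℂ) =ᵐ[μ] 0 := by
    rw [h]
    exact Lp.coeFn_zero ℂ 2 μ
  filter_upwards [h0, coeFn_laurentVec μ m p] with z h1 h2
  rw [h1, Pi.zero_apply] at h2
  exact (mul_eq_zero.1 h2.symm).resolve_left (z ^ m).coe_ne_zero

variable {μ} in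
theorem laurentVec_injective (hμ : μ.support.Infinite) (m : ℤ) :
    Function.Injective (laurentVec μ m) := by
  intro p q hpq
  rw [← sub_eq_zero]
  refine eq_zero_of_laurentVec_eq_zero hμ (m := m) ?_
  rw [laurentVec_sub, hpq, sub_self]

theorem laurentVec_X_pow (m : ℤ) (k : ℕ) :
    laurentVec μ m (X ^ k) = laurentVec μ (m + k) 1 := by
  refine laurentVec_congr μ fun z => ?_
  simp [zpow_add₀ z.coe_ne_zero]

theorem laurentSpan_eq_map (m : ℤ) (n : ℕ) :
    laurentSpan μ m n = (degreeLT ℂ n).map (laurentHom μ m) := by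
  classical
  rw [degreeLT_eq_span_X_pow, Submodule.map_span, laurentSpan]
  congr 1
  ext x
  simp only [Set.mem_range, Finset.coe_image, Finset.coe_range, Set.mem_image, Set.mem_Iio,
    exists_exists_and_eq_and]
  constructor
  · rintro ⟨k, rfl⟩
    exact ⟨k, k.2, laurentVec_X_pow μ m k⟩
  · rintro ⟨k, hk, rfl⟩
    exact ⟨⟨k, hk⟩, (laurentVec_X_pow μ m k).symm⟩

theorem mem_laurentSpan_iff {m : ℤ} {n : ℕ} {x : L2 μ} :
    x ∈ laurentSpan μ m n ↔ ∃ p ∈ degreeLT ℂ n, laurentVec μ m p = x := by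
  rw [laurentSpan_eq_map]
  exact Submodule.mem_map

variable {μ} in
theorem laurentVec_mem_laurentSpan {m : ℤ} {n : ℕ} {p : ℂ[X]} (hp : p ∈ degreeLT ℂ n) :
    laurentVec μ m p ∈ laurentSpan μ m n := (mem_laurentSpan_iff μ).2 ⟨p, hp, rfl⟩

theorem mem_laurentSpan_orthogonal_iff {m : ℤ} {n : ℕ} {x : L2 μ} :
    x ∈ (laurentSpan μ m n)ᗮ ↔ ∀ p ∈ degreeLT ℂ n, ⟪laurentVec μ m p, x⟫_ℂ = 0 := by
  rw [Submodule.mem_orthogonal]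
  constructor
  · exact fun h p hp => h _ (laurentVec_mem_laurentSpan hp)
  · rintro h y hy
    obtain ⟨p, hp, rfl⟩ := (mem_laurentSpan_iff μ).1 hy
    exact h p hp

variable {μ} in
theorem finrank_laurentSpan (hμ : μ.support.Infinite) (m : ℤ) (n : ℕ) :
    Module.finrank ℂ (laurentSpan μ m n) = n := by
  rw [laurentSpan_eq_map, ← ((degreeLT ℂ n).equivMapOfInjective (laurentHom μ m)
    (laurentVec_injective hμ m)).finrank_eq, (degreeLTEquiv ℂ n).finrank_eq]
  simp

end Laurent

/-! ### Reversed polynomials -/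

section Reversal

theorem natDegree_lt_of_mem_degreeLT {n : ℕ} {p : ℂ[X]} (hp : p ∈ degreeLT ℂ (n + 1)) :
    p.natDegree < n + 1 := by
  rw [mem_degreeLT, degree_lt_iff_coeff_zero] at hp
  exact Nat.lt_succ_iff.2 (natDegree_le_iff_coeff_eq_zero.2 fun k hk => hp k hk)

theorem X_mul_mem_degreeLT {n : ℕ} {p : ℂ[X]} (hp : p ∈ degreeLT ℂ n) :
    X * p ∈ degreeLT ℂ (n + 1) := by
  rw [mem_degreeLT] at *
  by_cases h : p = 0
  · simp [h]
  · rw [degree_mul, degree_X, degree_eq_natDegree h] at *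
    norm_cast at *
    omega

theorem revPoly_mem_degreeLT {n : ℕ} {p : ℂ[X]} (hp : p ∈ degreeLT ℂ (n + 1)) :
    revPoly n p ∈ degreeLT ℂ (n + 1) := by
  rw [mem_degreeLT, degree_lt_iff_coeff_zero] at *
  intro k hk
  rw [revPoly, coeff_reflect, revAt_eq_self_of_lt hk, coeff_map, hp k hk, map_zero]

theorem eval_revPoly {n : ℕ} {p : ℂ[X]} (hp : p ∈ degreeLT ℂ (n + 1)) (z : Circle) :
    (revPoly n p).eval (z : ℂ) = (z : ℂ) ^ n * starRingEnd ℂ (p.eval (z : ℂ)) := by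
  have hdeg : (p.map (starRingEnd ℂ)).natDegree ≤ n :=
    natDegree_map_le.trans (Nat.lt_succ_iff.1 (natDegree_lt_of_mem_degreeLT hp))
  have hz : starRingEnd ℂ (z : ℂ) = (z : ℂ)⁻¹ := by
    rw [← Circle.coe_inv_eq_conj, Circle.coe_inv]
  let _ : Invertible (starRingEnd ℂ (z : ℂ)) := invertibleOfNonzero (by simp)
  have h := eval₂_reflect_mul_pow (RingHom.id ℂ) (starRingEnd ℂ (z : ℂ)) n _ hdeg
  rw [eval₂_id, eval₂_id, eval_map, eval₂_at_apply, invOf_eq_inv, hz, inv_inv] at h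
  rw [← h, revPoly, mul_left_comm, ← mul_pow, mul_inv_cancel₀ z.coe_ne_zero, one_pow, mul_one]

theorem eval_zero_revPoly (n : ℕ) (p : ℂ[X]) :
    (revPoly n p).eval 0 = starRingEnd ℂ (p.coeff n) := by
  rw [← coeff_zero_eq_eval_zero, revPoly, coeff_reflect, coeff_map]
  simp

theorem revPoly_revPoly (n : ℕ) (p : ℂ[X]) : revPoly n (revPoly n p) = p := by
  ext k
  simp [revPoly, coeff_reflect]

theorem revPoly_X_mul_mem_degreeLT {n : ℕ} {p : ℂ[X]} (hp : p ∈ degreeLT ℂ n) :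
    revPoly n (X * p) ∈ degreeLT ℂ n := by
  rw [mem_degreeLT, degree_lt_iff_coeff_zero] at *
  intro k hk
  rw [revPoly, coeff_reflect, coeff_map]
  rcases hk.eq_or_lt with rfl | hk
  · simp
  · obtain ⟨j, rfl⟩ : ∃ j, k = j + 1 := ⟨k - 1, by omega⟩
    rw [revAt_eq_self_of_lt hk, coeff_X_mul, hp j (by omega), map_zero]

theorem inner_revPoly (μ : Measure Circle) [IsFiniteMeasure μ] {n : ℕ} {p q : ℂ[X]}
    (hp : p ∈ degreeLT ℂ (n + 1)) (hq : q ∈ degreeLT ℂ (n + 1)) :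
    ⟪laurentVec μ 0 (revPoly n p), laurentVec μ 0 (revPoly n q)⟫_ℂ
      = ⟪laurentVec μ 0 q, laurentVec μ 0 p⟫_ℂ := by
  rw [inner_laurentVec, inner_laurentVec]
  refine integral_congr_ae (Filter.Eventually.of_forall fun z => ?_)
  have hz : (z : ℂ) ^ n * starRingEnd ℂ ((z : ℂ) ^ n) = 1 := by
    rw [Complex.mul_conj', norm_pow, Circle.norm_coe]
    simp
  simp only [eval_revPoly hp, eval_revPoly hq, map_mul, Complex.conj_conj]
  rw [mul_mul_mul_comm, hz, one_mul, mul_comm]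

end Reversal

/-! ### Orthonormal polynomials and the Szegő recursion -/

section Orthonormal

variable (μ : Measure Circle) [IsFiniteMeasure μ]

/-- Gram-Schmidt: `φ_n` has degree `n`, a positive leading coefficient and norm one, and it is
orthogonal to its predecessors. -/
theorem orthoPoly_spec (hμ : μ.support.Infinite) (n : ℕ) :
    orthoPoly μ n ∈ degreeLT ℂ (n + 1) ∧ (∃ κ : ℝ, 0 < κ ∧ (orthoPoly μ n).coeff n = κ) ∧
      (∀ k < n, ⟪laurentVec μ 0 (orthoPoly μ k), laurentVec μ 0 (orthoPoly μ n)⟫_ℂ = 0) ∧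
      ‖laurentVec μ 0 (orthoPoly μ n)‖ = 1 := by
  induction n using Nat.strong_induction_on with
  | _ n ih =>
  set Φ : ℂ[X] := X ^ n - ∑ k : Fin n,
    C (⟪laurentVec μ 0 (orthoPoly μ k), laurentVec μ 0 (X ^ n)⟫_ℂ) * orthoPoly μ k with hΦ
  have heq : orthoPoly μ n = C ((‖laurentVec μ 0 Φ‖⁻¹ : ℝ) : ℂ) * Φ := by
    rw [orthoPoly]
  have hsum : ∑ k : Fin n, C (⟪laurentVec μ 0 (orthoPoly μ k), laurentVec μ 0 (X ^ n)⟫_ℂ)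
      * orthoPoly μ k ∈ degreeLT ℂ n := by
    refine Submodule.sum_mem _ fun k _ => ?_
    rw [C_mul']
    exact Submodule.smul_mem _ _ (degreeLT_mono k.2 (ih k k.2).1)
  have hcoeff : Φ.coeff n = 1 := by
    rw [mem_degreeLT, degree_lt_iff_coeff_zero] at hsum
    rw [hΦ, coeff_sub, hsum n le_rfl, coeff_X_pow_self, sub_zero]
  have hdeg : Φ ∈ degreeLT ℂ (n + 1) := by
    refine Submodule.sub_mem _ ?_ (degreeLT_mono n.le_succ hsum)
    rw [mem_degreeLT, degree_X_pow]
    exact_mod_cast n.lt_succ_self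
  have hne : laurentVec μ 0 Φ ≠ 0 := by
    intro h0
    rw [eq_zero_of_laurentVec_eq_zero hμ h0] at hcoeff
    simp at hcoeff
  have hpos : 0 < ‖laurentVec μ 0 Φ‖⁻¹ := inv_pos.2 (norm_pos_iff.2 hne)
  have horth : ∀ k < n, ⟪laurentVec μ 0 (orthoPoly μ k), laurentVec μ 0 Φ⟫_ℂ = 0 := by
    intro k hk
    rw [hΦ, laurentVec_sub, laurentVec_sum, inner_sub_right, inner_sum,
      Finset.sum_eq_single (⟨k, hk⟩ : Fin n)]
    · rw [laurentVec_C_mul, inner_smul_right, inner_self_eq_norm_sq_to_K, (ih k hk).2.2.2]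
      simp
    · intro j _ hj
      rw [laurentVec_C_mul, inner_smul_right]
      have hjk : (j : ℕ) ≠ k := fun h => hj (Fin.ext h)
      rcases lt_or_gt_of_ne hjk with h | h
      · rw [inner_eq_zero_symm.1 ((ih k hk).2.2.1 j h), mul_zero]
      · rw [(ih j j.2).2.2.1 k h, mul_zero]
    · simp
  refine ⟨?_, ⟨_, hpos, ?_⟩, fun k hk => ?_, ?_⟩
  · rw [heq, C_mul']
    exact Submodule.smul_mem _ _ hdeg
  · rw [heq, coeff_C_mul, hcoeff, mul_one]
  · rw [heq, laurentVec_C_mul, inner_smul_right, horth k hk, mul_zero]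
  · rw [heq, laurentVec_C_mul, norm_smul, Complex.norm_real, norm_inv, norm_norm,
      inv_mul_cancel₀ (norm_ne_zero_iff.2 hne)]

variable {μ}

theorem orthoPoly_mem_degreeLT (hμ : μ.support.Infinite) (n : ℕ) :
    orthoPoly μ n ∈ degreeLT ℂ (n + 1) := (orthoPoly_spec μ hμ n).1

theorem orthoPoly_coeff_ne_zero (hμ : μ.support.Infinite) (n : ℕ) :
    (orthoPoly μ n).coeff n ≠ 0 := by
  obtain ⟨κ, hκ, h⟩ := (orthoPoly_spec μ hμ n).2.1
  rw [h]
  exact Complex.ofReal_ne_zero.2 hκ.ne'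

theorem norm_laurentVec_orthoPoly (hμ : μ.support.Infinite) (m : ℤ) (n : ℕ) :
    ‖laurentVec μ m (orthoPoly μ n)‖ = 1 := by
  rw [norm_laurentVec_eq, (orthoPoly_spec μ hμ n).2.2.2]

theorem orthoPoly_leadingCoeff (hμ : μ.support.Infinite) (n : ℕ) :
    (orthoPoly μ n).leadingCoeff = (orthoPoly μ n).coeff n := by
  rw [leadingCoeff, natDegree_eq_of_le_of_coeff_ne_zero
    (Nat.lt_succ_iff.1 (natDegree_lt_of_mem_degreeLT (orthoPoly_mem_degreeLT hμ n)))
    (orthoPoly_coeff_ne_zero hμ n)]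

theorem revOrthoPoly_mem_degreeLT (hμ : μ.support.Infinite) (n : ℕ) :
    revPoly n (orthoPoly μ n) ∈ degreeLT ℂ (n + 1) :=
  revPoly_mem_degreeLT (orthoPoly_mem_degreeLT hμ n)

theorem norm_laurentVec_revOrthoPoly (hμ : μ.support.Infinite) (m : ℤ) (n : ℕ) :
    ‖laurentVec μ m (revPoly n (orthoPoly μ n))‖ = 1 := by
  have h := orthoPoly_mem_degreeLT hμ n
  rw [← norm_laurentVec_orthoPoly hμ 0 n, norm_laurentVec_eq, @norm_eq_sqrt_re_inner ℂ,
    @norm_eq_sqrt_re_inner ℂ, inner_revPoly μ h h]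

/-- Splitting off the leading term. -/
theorem exists_eq_orthoPoly_add (hμ : μ.support.Infinite) {n : ℕ} {p : ℂ[X]}
    (hp : p ∈ degreeLT ℂ (n + 1)) :
    ∃ (t : ℂ) (s : ℂ[X]), s ∈ degreeLT ℂ n ∧ p = C t * orthoPoly μ n + s := by
  refine ⟨p.coeff n / (orthoPoly μ n).coeff n,
    p - C (p.coeff n / (orthoPoly μ n).coeff n) * orthoPoly μ n, ?_, by ring⟩
  have h := orthoPoly_mem_degreeLT hμ n
  rw [mem_degreeLT, degree_lt_iff_coeff_zero] at *
  intro k hk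
  rcases hk.eq_or_lt with rfl | hk
  · rw [coeff_sub, coeff_C_mul, div_mul_cancel₀ _ (orthoPoly_coeff_ne_zero hμ _), sub_self]
  · rw [coeff_sub, coeff_C_mul, hp k hk, h k hk, mul_zero, sub_zero]

/-- Splitting off the constant term. -/
theorem exists_eq_revOrthoPoly_add (hμ : μ.support.Infinite) {n : ℕ} {p : ℂ[X]}
    (hp : p ∈ degreeLT ℂ (n + 1)) :
    ∃ (t : ℂ) (s : ℂ[X]), s ∈ degreeLT ℂ n ∧
      p = C t * revPoly n (orthoPoly μ n) + X * s := by
  have h0 : (revPoly n (orthoPoly μ n)).coeff 0 ≠ 0 := by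
    rw [coeff_zero_eq_eval_zero, eval_zero_revPoly, _root_.map_ne_zero]
    exact orthoPoly_coeff_ne_zero hμ n
  set t : ℂ := p.coeff 0 / (revPoly n (orthoPoly μ n)).coeff 0 with ht
  set r := p - C t * revPoly n (orthoPoly μ n) with hr
  have hr0 : r.coeff 0 = 0 := by
    rw [hr, coeff_sub, coeff_C_mul, ht, div_mul_cancel₀ _ h0, sub_self]
  have hrd : r ∈ degreeLT ℂ (n + 1) := by
    refine Submodule.sub_mem _ hp ?_
    rw [C_mul']
    exact Submodule.smul_mem _ _ (revOrthoPoly_mem_degreeLT hμ n)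
  refine ⟨t, r.divX, ?_, ?_⟩
  · rw [mem_degreeLT, degree_lt_iff_coeff_zero] at *
    intro k hk
    rw [coeff_divX]
    exact hrd _ (by omega)
  · have := X_mul_divX_add r
    rw [hr0, C_0, add_zero] at this
    rw [this, hr]
    ring

theorem inner_orthoPoly (hμ : μ.support.Infinite) {n : ℕ} {s : ℂ[X]} (hs : s ∈ degreeLT ℂ n) :
    ⟪laurentVec μ 0 (orthoPoly μ n), laurentVec μ 0 s⟫_ℂ = 0 := by
  suffices h : ∀ k ≤ n, ∀ s ∈ degreeLT ℂ k,
      ⟪laurentVec μ 0 (orthoPoly μ n), laurentVec μ 0 s⟫_ℂ = 0 from h n le_rfl s hs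
  intro k
  induction k with
  | zero =>
    intro _ s hs
    have : s = 0 := by simpa [mem_degreeLT] using hs
    rw [this, laurentVec_zero, inner_zero_right]
  | succ k ih =>
    intro hk s hs
    obtain ⟨t, r, hr, rfl⟩ := exists_eq_orthoPoly_add hμ hs
    rw [laurentVec_add, laurentVec_C_mul, inner_add_right, inner_smul_right, ih (by omega) r hr,
      inner_eq_zero_symm.1 ((orthoPoly_spec μ hμ n).2.2.1 k hk)]
    simp

theorem inner_revOrthoPoly_X_mul (hμ : μ.support.Infinite) {n : ℕ} {s : ℂ[X]}
    (hs : s ∈ degreeLT ℂ n) :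
    ⟪laurentVec μ 0 (revPoly n (orthoPoly μ n)), laurentVec μ 0 (X * s)⟫_ℂ = 0 := by
  have h := revPoly_X_mul_mem_degreeLT hs
  rw [← revPoly_revPoly n (X * s), inner_revPoly μ (orthoPoly_mem_degreeLT hμ n)
    (degreeLT_mono n.le_succ h), inner_eq_zero_symm]
  exact inner_orthoPoly hμ h

/-- The Szegő recursion.  The combination of `z φ_n` and `φ_{n+1}` whose leading term cancels is
orthogonal to `z, …, z^n`, hence a multiple of `φ_n^*`; the multiple is read off at `z = 0` and the
normalization follows from Pythagoras. -/
theorem szego_recursion (hμ : μ.support.Infinite) (n : ℕ) :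
    0 < rho μ (n + 1) ∧
    C (rho μ (n + 1) : ℂ) * orthoPoly μ (n + 1)
      = X * orthoPoly μ n + C (schurParam μ (n + 1)) * revPoly n (orthoPoly μ n) := by
  obtain ⟨κ, hκ, hcκ⟩ := (orthoPoly_spec μ hμ n).2.1
  obtain ⟨κ', hκ', hcκ'⟩ := (orthoPoly_spec μ hμ (n + 1)).2.1
  have hκ0 : (κ : ℂ) ≠ 0 := Complex.ofReal_ne_zero.2 hκ.ne'
  have hκ0' : (κ' : ℂ) ≠ 0 := Complex.ofReal_ne_zero.2 hκ'.ne'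
  have ha : (orthoPoly μ (n + 1)).eval 0 = schurParam μ (n + 1) * κ' := by
    rw [schurParam, orthoPoly_leadingCoeff hμ, hcκ', div_mul_cancel₀ _ hκ0']
  set r := X * orthoPoly μ n - C ((κ / κ' : ℝ) : ℂ) * orthoPoly μ (n + 1) with hr
  have hrd : r ∈ degreeLT ℂ (n + 1) := by
    have h1 := X_mul_mem_degreeLT (orthoPoly_mem_degreeLT hμ n)
    have h2 := orthoPoly_mem_degreeLT hμ (n + 1)
    rw [mem_degreeLT, degree_lt_iff_coeff_zero] at *
    intro k hk
    rcases hk.eq_or_lt with rfl | hk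
    · rw [hr, coeff_sub, coeff_X_mul, coeff_C_mul, hcκ, hcκ']
      push_cast
      rw [div_mul_cancel₀ _ hκ0', sub_self]
    · rw [hr, coeff_sub, coeff_C_mul, h1 k hk, h2 k hk, mul_zero, sub_zero]
  have horth : ∀ s ∈ degreeLT ℂ n, ⟪laurentVec μ 0 r, laurentVec μ 0 (X * s)⟫_ℂ = 0 := by
    intro s hs
    rw [hr, laurentVec_sub, laurentVec_C_mul, inner_sub_left, inner_smul_left, inner_X_mul_X_mul,
      inner_orthoPoly hμ hs, inner_orthoPoly hμ (X_mul_mem_degreeLT hs), mul_zero, sub_zero]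
  obtain ⟨t, s, hs, hrts⟩ := exists_eq_revOrthoPoly_add hμ hrd
  have hXs : X * s = 0 := by
    refine eq_zero_of_laurentVec_eq_zero hμ (m := 0) ?_
    rw [← inner_self_eq_zero (𝕜 := ℂ)]
    have h1 := horth s hs
    rwa [hrts, laurentVec_add, laurentVec_C_mul, inner_add_left, inner_smul_left,
      inner_revOrthoPoly_X_mul hμ hs, mul_zero, zero_add] at h1
  rw [hXs, add_zero] at hrts
  have ht : t = -schurParam μ (n + 1) := by
    have h0 : r.eval 0 = (C t * revPoly n (orthoPoly μ n)).eval 0 := by rw [hrts]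
    rw [hr, eval_sub, eval_mul, eval_X, zero_mul, eval_mul, eval_C, eval_mul, eval_C,
      eval_zero_revPoly, hcκ, ha, Complex.conj_ofReal] at h0
    push_cast at h0
    field_simp at h0
    refine mul_left_cancel₀ hκ0 ?_
    linear_combination -h0
  have hrec : C ((κ / κ' : ℝ) : ℂ) * orthoPoly μ (n + 1)
      = X * orthoPoly μ n + C (schurParam μ (n + 1)) * revPoly n (orthoPoly μ n) := by
    rw [ht, C_neg] at hrts
    linear_combination -(hr.symm.trans hrts)
  have hsq : (κ / κ') ^ 2 = 1 - ‖schurParam μ (n + 1)‖ ^ 2 := by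
    have hX : laurentVec μ 0 (X * orthoPoly μ n)
        = ((κ / κ' : ℝ) : ℂ) • laurentVec μ 0 (orthoPoly μ (n + 1))
          + (-schurParam μ (n + 1)) • laurentVec μ 0 (revPoly n (orthoPoly μ n)) := by
      rw [← laurentVec_C_mul, hrec, laurentVec_add, laurentVec_C_mul]
      module
    have h1 := norm_laurentVec_orthoPoly hμ (0 + 1) n
    rw [← laurentVec_X_mul, hX] at h1
    have h2 := norm_add_sq_eq_norm_sq_add_norm_sq_of_inner_eq_zero (𝕜 := ℂ)
      (((κ / κ' : ℝ) : ℂ) • laurentVec μ 0 (orthoPoly μ (n + 1)))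
      ((-schurParam μ (n + 1)) • laurentVec μ 0 (revPoly n (orthoPoly μ n)))
      (by rw [inner_smul_left, inner_smul_right,
        inner_orthoPoly hμ (revOrthoPoly_mem_degreeLT hμ n), mul_zero, mul_zero])
    rw [h1, norm_smul, norm_smul, norm_laurentVec_orthoPoly hμ, norm_laurentVec_revOrthoPoly hμ,
      norm_neg, Complex.norm_real, Real.norm_of_nonneg (by positivity)] at h2
    linarith
  have hrho : rho μ (n + 1) = κ / κ' := by
    rw [rho, ← hsq, Real.sqrt_sq (by positivity)]
  rw [hrho]
  exact ⟨by positivity, hrec⟩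

/-- The companion of the Szegő recursion for the reversed polynomials. -/
theorem laurentVec_revOrthoPoly_succ (hμ : μ.support.Infinite) (m : ℤ) (n : ℕ) :
    laurentVec μ m (revPoly (n + 1) (orthoPoly μ (n + 1)))
      = (rho μ (n + 1) : ℂ) • laurentVec μ m (revPoly n (orthoPoly μ n))
        + starRingEnd ℂ (schurParam μ (n + 1)) • laurentVec μ m (orthoPoly μ (n + 1)) := by
  obtain ⟨hρ, hrec⟩ := szego_recursion hμ n
  have hρ0 : (rho μ (n + 1) : ℂ) ≠ 0 := Complex.ofReal_ne_zero.2 hρ.ne'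
  have hsq : (rho μ (n + 1) : ℂ) ^ 2
      = 1 - schurParam μ (n + 1) * starRingEnd ℂ (schurParam μ (n + 1)) := by
    rw [Complex.mul_conj', ← Complex.ofReal_pow, rho, Real.sq_sqrt]
    · push_cast; ring
    · exact (Real.sqrt_pos.1 hρ).le
  rw [← laurentVec_C_mul, ← laurentVec_C_mul, ← laurentVec_add]
  refine laurentVec_congr μ fun z => ?_
  congr 1
  have hz := congrArg (eval (z : ℂ)) hrec
  simp only [eval_add, eval_mul, eval_C, eval_X, eval_revPoly (orthoPoly_mem_degreeLT hμ n),
    eval_revPoly (orthoPoly_mem_degreeLT hμ (n + 1))] at hz ⊢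
  have hzc := congrArg (starRingEnd ℂ) hz
  simp only [map_add, map_mul, map_pow, Complex.conj_ofReal, Complex.conj_conj] at hzc
  have hzz : (z : ℂ) * starRingEnd ℂ (z : ℂ) = 1 := by
    rw [Complex.mul_conj', Circle.norm_coe]; simp
  have hzn : (z : ℂ) ^ n * starRingEnd ℂ (z : ℂ) ^ n = 1 := by
    rw [← mul_pow, hzz, one_pow]
  refine mul_left_cancel₀ hρ0 ?_
  generalize eval (z : ℂ) (orthoPoly μ n) = x at *
  generalize eval (z : ℂ) (orthoPoly μ (n + 1)) = y at *
  generalize starRingEnd ℂ x = x' at *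
  generalize starRingEnd ℂ y = y' at *
  generalize schurParam μ (n + 1) = a at *
  generalize starRingEnd ℂ a = a' at *
  generalize starRingEnd ℂ (z : ℂ) = z' at *
  linear_combination ((z : ℂ) ^ (n + 1)) * hzc + (z : ℂ) ^ n * x' * hzz
    + a' * z * x * hzn - a' * hz - (z : ℂ) ^ n * x' * hsq

end Orthonormal

/-! ### The subspaces `P_{m,n}` and their orthogonal complements -/

section Concrete

variable {μ : Measure Circle}

theorem inner_mulOp_mulOp (x y : L2 μ) : ⟪mulOp μ x, mulOp μ y⟫_ℂ = ⟪x, y⟫_ℂ :=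
  LinearIsometry.inner_map_map ⟨(mulOp μ : L2 μ →ₗ[ℂ] L2 μ), norm_mulOp μ⟩ x y

theorem eq_zero_of_inner_smul_add {t : ℂ} {x y : L2 μ} (hx : ‖x‖ = 1) (hxy : ⟪x, y⟫_ℂ = 0)
    (h : ⟪x, t • x + y⟫_ℂ = 0) : t = 0 := by
  rw [inner_add_right, inner_smul_right, hxy, inner_self_eq_norm_sq_to_K, hx] at h
  simpa using h

variable [IsFiniteMeasure μ]

theorem isDefectData_laurentSpan (hμ : μ.support.Infinite) (m : ℤ) (n : ℕ) :
    IsDefectData (mulOp μ) (laurentSpan μ m (n + 1)) (laurentVec μ m (orthoPoly μ n))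
      (laurentVec μ m (revPoly n (orthoPoly μ n))) (laurentVec μ m (orthoPoly μ (n + 1)))
      (rho μ (n + 1)) (schurParam μ (n + 1)) where
  norm_map := norm_mulOp μ
  e_mem := laurentVec_mem_laurentSpan (orthoPoly_mem_degreeLT hμ n)
  norm_e := norm_laurentVec_orthoPoly hμ m n
  f_mem := laurentVec_mem_laurentSpan (revOrthoPoly_mem_degreeLT hμ n)
  norm_f := norm_laurentVec_revOrthoPoly hμ m n
  g_mem := by
    rw [mem_laurentSpan_orthogonal_iff]
    intro p hp
    rw [inner_laurentVec_eq, inner_eq_zero_symm]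
    exact inner_orthoPoly hμ hp
  norm_g := norm_laurentVec_orthoPoly hμ m (n + 1)
  rho_pos := (szego_recursion hμ n).1
  map_e := by
    rw [mulOp_laurentVec, ← laurentVec_C_mul, (szego_recursion hμ n).2, laurentVec_add,
      laurentVec_C_mul, add_sub_cancel_right]
  map_mem := by
    intro x hx hex
    obtain ⟨p, hp, rfl⟩ := (mem_laurentSpan_iff μ).1 hx
    obtain ⟨t, s, hs, rfl⟩ := exists_eq_orthoPoly_add hμ hp
    rw [laurentVec_add, laurentVec_C_mul] at hex
    have ht := eq_zero_of_inner_smul_add (norm_laurentVec_orthoPoly hμ m n)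
      (by rw [inner_laurentVec_eq, inner_orthoPoly hμ hs]) hex
    rw [mulOp_laurentVec, ht, C_0, zero_mul, zero_add]
    exact laurentVec_mem_laurentSpan (X_mul_mem_degreeLT hs)
  inner_map := by
    intro x hx hex
    obtain ⟨p, hp, rfl⟩ := (mem_laurentSpan_iff μ).1 hx
    obtain ⟨t, s, hs, rfl⟩ := exists_eq_orthoPoly_add hμ hp
    rw [laurentVec_add, laurentVec_C_mul] at hex
    have ht := eq_zero_of_inner_smul_add (norm_laurentVec_orthoPoly hμ m n)
      (by rw [inner_laurentVec_eq, inner_orthoPoly hμ hs]) hex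
    rw [mulOp_laurentVec, ht, C_0, zero_mul, zero_add, inner_laurentVec_eq,
      inner_revOrthoPoly_X_mul hμ hs]
  exists_map_eq := by
    intro y hy hfy
    obtain ⟨p, hp, rfl⟩ := (mem_laurentSpan_iff μ).1 hy
    obtain ⟨t, s, hs, rfl⟩ := exists_eq_revOrthoPoly_add hμ hp
    rw [laurentVec_add, laurentVec_C_mul] at hfy
    have ht := eq_zero_of_inner_smul_add (norm_laurentVec_revOrthoPoly hμ m n)
      (by rw [inner_laurentVec_eq, inner_revOrthoPoly_X_mul hμ hs]) hfy
    refine ⟨laurentVec μ m s, laurentVec_mem_laurentSpan (degreeLT_mono n.le_succ hs), ?_, ?_⟩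
    · rw [inner_laurentVec_eq, inner_orthoPoly hμ hs]
    · rw [mulOp_laurentVec, ht, C_0, zero_mul, zero_add]

theorem laurentVec_sub_one_X_mul (m : ℤ) (p : ℂ[X]) :
    laurentVec μ (m - 1) (X * p) = laurentVec μ m p := by
  rw [laurentVec_X_mul, sub_add_cancel]

theorem mulOp_laurentVec_sub_one (m : ℤ) (p : ℂ[X]) :
    mulOp μ (laurentVec μ (m - 1) p) = laurentVec μ m p := by
  rw [mulOp_laurentVec, laurentVec_sub_one_X_mul]

theorem isDefectData_laurentSpan_orthogonal (hμ : μ.support.Infinite) (m : ℤ) (n : ℕ) :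
    IsDefectData (mulOp μ) (laurentSpan μ m (n + 1))ᗮ
      (laurentVec μ (m - 1) (revPoly (n + 1) (orthoPoly μ (n + 1))))
      (laurentVec μ m (orthoPoly μ (n + 1))) (laurentVec μ m (revPoly n (orthoPoly μ n)))
      (rho μ (n + 1)) (-starRingEnd ℂ (schurParam μ (n + 1))) := by
  -- `x ⟂ P_{m,n+1}` and `x ⟂ z^{m-1} φ_{n+1}^*` together say that `x ⟂ P_{m-1,n+2}`
  have hperp : ∀ x ∈ (laurentSpan μ m (n + 1))ᗮ,
      ⟪laurentVec μ (m - 1) (revPoly (n + 1) (orthoPoly μ (n + 1))), x⟫_ℂ = 0 →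
      mulOp μ x ∈ (laurentSpan μ m (n + 1 + 1))ᗮ := by
    intro x hx hex
    rw [mem_laurentSpan_orthogonal_iff] at hx ⊢
    intro p hp
    obtain ⟨t, s, hs, rfl⟩ := exists_eq_revOrthoPoly_add hμ hp
    rw [← mulOp_laurentVec_sub_one, inner_mulOp_mulOp, laurentVec_add, laurentVec_C_mul,
      inner_add_left, inner_smul_left, hex, laurentVec_sub_one_X_mul, hx s hs]
    simp
  refine
  { norm_map := norm_mulOp μ
    e_mem := ?_
    norm_e := norm_laurentVec_revOrthoPoly hμ _ _
    f_mem := (isDefectData_laurentSpan hμ m n).g_mem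
    norm_f := norm_laurentVec_orthoPoly hμ m (n + 1)
    g_mem := Submodule.le_orthogonal_orthogonal _ (isDefectData_laurentSpan hμ m n).f_mem
    norm_g := norm_laurentVec_revOrthoPoly hμ m n
    rho_pos := (szego_recursion hμ n).1
    map_e := ?_
    map_mem := ?_
    inner_map := ?_
    exists_map_eq := ?_ }
  · rw [mem_laurentSpan_orthogonal_iff]
    intro p hp
    rw [← laurentVec_sub_one_X_mul, inner_laurentVec_eq, inner_eq_zero_symm]
    exact inner_revOrthoPoly_X_mul hμ hp
  · rw [mulOp_laurentVec_sub_one, laurentVec_revOrthoPoly_succ hμ, neg_smul, sub_neg_eq_add]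
  · intro x hx hex
    have h := hperp x hx hex
    rw [mem_laurentSpan_orthogonal_iff] at h ⊢
    exact fun p hp => h p (degreeLT_mono (n + 1).le_succ hp)
  · intro x hx hex
    have h := hperp x hx hex
    rw [mem_laurentSpan_orthogonal_iff] at h
    exact h _ (orthoPoly_mem_degreeLT hμ (n + 1))
  · intro y hy hfy
    obtain ⟨x, rfl⟩ := mulOp_surjective μ y
    rw [mem_laurentSpan_orthogonal_iff] at hy
    have key : ∀ p ∈ degreeLT ℂ (n + 1 + 1), ⟪laurentVec μ (m - 1) p, x⟫_ℂ = 0 := by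
      intro p hp
      obtain ⟨t, s, hs, rfl⟩ := exists_eq_orthoPoly_add hμ hp
      rw [← inner_mulOp_mulOp, mulOp_laurentVec_sub_one, laurentVec_add, laurentVec_C_mul,
        inner_add_left, inner_smul_left, hfy, hy s hs]
      simp
    refine ⟨x, ?_, key _ (revOrthoPoly_mem_degreeLT hμ (n + 1)), rfl⟩
    rw [mem_laurentSpan_orthogonal_iff]
    intro p hp
    rw [← laurentVec_sub_one_X_mul]
    exact key _ (X_mul_mem_degreeLT hp)

theorem laurentSpan_sup_span (hμ : μ.support.Infinite) (m : ℤ) (n : ℕ) :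
    laurentSpan μ m n ⊔ Submodule.span ℂ {laurentVec μ m (orthoPoly μ n)}
      = laurentSpan μ m (n + 1) := by
  refine le_antisymm (sup_le ?_ ?_) ?_
  · intro x hx
    obtain ⟨p, hp, rfl⟩ := (mem_laurentSpan_iff μ).1 hx
    exact laurentVec_mem_laurentSpan (degreeLT_mono n.le_succ hp)
  · rw [Submodule.span_singleton_le_iff_mem]
    exact laurentVec_mem_laurentSpan (orthoPoly_mem_degreeLT hμ n)
  · intro x hx
    obtain ⟨p, hp, rfl⟩ := (mem_laurentSpan_iff μ).1 hx
    obtain ⟨t, s, hs, rfl⟩ := exists_eq_orthoPoly_add hμ hp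
    rw [laurentVec_add, laurentVec_C_mul, add_comm]
    exact Submodule.add_mem_sup (laurentVec_mem_laurentSpan hs)
      (Submodule.smul_mem _ _ (Submodule.mem_span_singleton_self _))

theorem orthogonal_laurentSpan_orthogonal_sup_span (hμ : μ.support.Infinite) (m : ℤ) (n : ℕ) :
    ((laurentSpan μ m (n + 1))ᗮ ⊔
      Submodule.span ℂ {laurentVec μ m (revPoly n (orthoPoly μ n))})ᗮ
      = laurentSpan μ (m + 1) n := by
  rw [← Submodule.inf_orthogonal, Submodule.orthogonal_orthogonal]
  ext x
  rw [Submodule.mem_inf, Submodule.mem_orthogonal_singleton_iff_inner_right]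
  constructor
  · rintro ⟨hx, hfx⟩
    obtain ⟨p, hp, rfl⟩ := (mem_laurentSpan_iff μ).1 hx
    obtain ⟨t, s, hs, rfl⟩ := exists_eq_revOrthoPoly_add hμ hp
    rw [laurentVec_add, laurentVec_C_mul] at hfx
    have ht := eq_zero_of_inner_smul_add (norm_laurentVec_revOrthoPoly hμ m n)
      (by rw [inner_laurentVec_eq, inner_revOrthoPoly_X_mul hμ hs]) hfx
    rw [ht, C_0, zero_mul, zero_add, laurentVec_X_mul]
    exact laurentVec_mem_laurentSpan hs
  · intro hx
    obtain ⟨s, hs, rfl⟩ := (mem_laurentSpan_iff μ).1 hx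
    rw [← laurentVec_X_mul]
    refine ⟨laurentVec_mem_laurentSpan (X_mul_mem_degreeLT hs), ?_⟩
    rw [inner_laurentVec_eq, inner_revOrthoPoly_X_mul hμ hs]

theorem mulOp_add_smul_eq_paraP (m : ℤ) (n : ℕ) (u : ℂ) :
    mulOp μ (laurentVec μ m (orthoPoly μ n)) + u • laurentVec μ m (revPoly n (orthoPoly μ n))
      = laurentVec μ m (paraP μ (n + 1) u) := by
  rw [paraP, laurentVec_add, laurentVec_C_mul, mulOp_laurentVec, Nat.add_sub_cancel]

theorem mulOp_add_smul_eq_paraQ (m : ℤ) (n : ℕ) (u : ℂ) :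
    mulOp μ (laurentVec μ (m - 1) (revPoly n (orthoPoly μ n)))
      + (-starRingEnd ℂ u) • laurentVec μ m (orthoPoly μ n) = laurentVec μ m (paraQ μ n u) := by
  rw [paraQ, laurentVec_sub, laurentVec_C_mul, mulOp_laurentVec_sub_one, neg_smul, sub_eq_add_neg]

/-- Were a normal truncation on `P_{m,n}` not unitary, `U` would leave invariant a subspace of
`P_{m,n}` of codimension at most two, which is nonzero in dimension at least three; but multiplying
a nonzero polynomial by powers of `z` eventually leaves `P_{m,n}`. -/
theorem mem_unitary_of_isStarNormal_laurentSpan (hμ : μ.support.Infinite) {m : ℤ} {n : ℕ}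
    (hn : 2 ≤ n) {A : laurentSpan μ m (n + 1) →L[ℂ] laurentSpan μ m (n + 1)}
    (hA : IsTruncationOn (mulOp μ) (laurentSpan μ m (n + 1)) A) (hnormal : IsStarNormal A) :
    A ∈ unitary (laurentSpan μ m (n + 1) →L[ℂ] laurentSpan μ m (n + 1)) := by
  refine ((isDefectData_laurentSpan hμ m n).mem_unitary_or_exists_reducing hA
    hnormal).resolve_right ?_
  rintro ⟨d, -, hinv, -⟩
  set e := laurentVec μ m (orthoPoly μ n)
  let L : laurentSpan μ m (n + 1) →ₗ[ℂ] ℂ × ℂ :=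
    (((innerSL ℂ e : L2 μ →L[ℂ] ℂ) : L2 μ →ₗ[ℂ] ℂ).prod
      ((innerSL ℂ d : L2 μ →L[ℂ] ℂ) : L2 μ →ₗ[ℂ] ℂ)) ∘ₗ (laurentSpan μ m (n + 1)).subtype
  have hL : LinearMap.ker L ≠ ⊥ := by
    refine LinearMap.ker_ne_bot_of_finrank_lt ?_
    rw [finrank_laurentSpan hμ, Module.finrank_prod, Module.finrank_self]
    omega
  obtain ⟨⟨x, hx⟩, hxL, hx0⟩ := Submodule.exists_mem_ne_zero_of_ne_bot hL
  obtain ⟨p, hp, rfl⟩ := (mem_laurentSpan_iff μ).1 hx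
  have hp0 : p ≠ 0 := by
    rintro rfl
    exact hx0 (Subtype.ext (laurentVec_zero μ m))
  have hLx : (⟪e, laurentVec μ m p⟫_ℂ, ⟪d, laurentVec μ m p⟫_ℂ) = ((0, 0) : ℂ × ℂ) := hxL
  have hpow : ∀ k : ℕ, laurentVec μ m (X ^ k * p) ∈ laurentSpan μ m (n + 1) ∧
      ⟪e, laurentVec μ m (X ^ k * p)⟫_ℂ = 0 ∧ ⟪d, laurentVec μ m (X ^ k * p)⟫_ℂ = 0 := by
    intro k
    induction k with
    | zero =>
      rw [pow_zero, one_mul]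
      exact ⟨hx, (Prod.mk.inj hLx).1, (Prod.mk.inj hLx).2⟩
    | succ k ih =>
      rw [pow_succ', mul_assoc, ← mulOp_laurentVec]
      exact hinv _ ih.1 ih.2.1 ih.2.2
  obtain ⟨q, hq, hqp⟩ := (mem_laurentSpan_iff μ).1 (hpow (n + 1)).1
  rw [laurentVec_injective hμ m hqp, mem_degreeLT, degree_mul, degree_X_pow,
    degree_eq_natDegree hp0] at hq
  norm_cast at hq
  omega

/-- Were a normal truncation on `P_{m,n}ᗮ` not unitary, a subspace `K` of finite codimension would
reduce `U`.  As `K` is orthogonal to `z^m`, it is orthogonal to all `z^{m+k}`, `k ≥ 0`; but some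
nonzero combination of these vectors lies in `K`. -/
theorem mem_unitary_of_isStarNormal_laurentSpan_orthogonal (hμ : μ.support.Infinite) {m : ℤ}
    {n : ℕ} {A : (laurentSpan μ m (n + 1))ᗮ →L[ℂ] (laurentSpan μ m (n + 1))ᗮ}
    (hA : IsTruncationOn (mulOp μ) (laurentSpan μ m (n + 1))ᗮ A) (hnormal : IsStarNormal A) :
    A ∈ unitary ((laurentSpan μ m (n + 1))ᗮ →L[ℂ] (laurentSpan μ m (n + 1))ᗮ) := by
  refine ((isDefectData_laurentSpan_orthogonal hμ m n).mem_unitary_or_exists_reducing hA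
    hnormal).resolve_right ?_
  rintro ⟨d, -, -, hsurj⟩
  set e := laurentVec μ (m - 1) (revPoly (n + 1) (orthoPoly μ (n + 1)))
  have hpow : ∀ (k : ℕ) (x : L2 μ), x ∈ (laurentSpan μ m (n + 1))ᗮ → ⟪e, x⟫_ℂ = 0 →
      ⟪d, x⟫_ℂ = 0 → ⟪laurentVec μ m (X ^ k), x⟫_ℂ = 0 := by
    intro k
    induction k with
    | zero =>
      intro x hx _ _
      refine (mem_laurentSpan_orthogonal_iff μ).1 hx _ ?_
      rw [mem_degreeLT, pow_zero, degree_one]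
      exact_mod_cast n.succ_pos
    | succ k ih =>
      intro x hx hex hdx
      obtain ⟨y, hy, ⟨hey, hdy⟩, rfl⟩ := hsurj x hx hex hdx
      rw [pow_succ', ← mulOp_laurentVec, inner_mulOp_mulOp, ih y hy hey hdy]
  have hpoly : ∀ (p : ℂ[X]) (x : L2 μ), x ∈ (laurentSpan μ m (n + 1))ᗮ → ⟪e, x⟫_ℂ = 0 →
      ⟪d, x⟫_ℂ = 0 → ⟪laurentVec μ m p, x⟫_ℂ = 0 := by
    intro p x hx hex hdx
    induction p using Polynomial.induction_on' with
    | add p q hp hq => rw [laurentVec_add, inner_add_left, hp, hq, add_zero]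
    | monomial k a =>
      rw [← C_mul_X_pow_eq_monomial, laurentVec_C_mul, inner_smul_left, hpow k x hx hex hdx,
        mul_zero]
  let F : Submodule ℂ (L2 μ) := laurentSpan μ m (n + 1) ⊔ Submodule.span ℂ {e, d}
  have hfin : FiniteDimensional ℂ (Submodule.span ℂ {e, d}) :=
    FiniteDimensional.span_of_finite ℂ (Set.toFinite _)
  have hF : FiniteDimensional ℂ F := inferInstance
  let L : ℂ[X] →ₗ[ℂ] F := (F.orthogonalProjectionOnto : L2 μ →ₗ[ℂ] F) ∘ₗ laurentHom μ m
  have hL : ¬ Function.Injective L := fun h =>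
    Polynomial.not_finite (R := ℂ) (Module.Finite.of_injective L h)
  rw [injective_iff_map_eq_zero] at hL
  push Not at hL
  obtain ⟨p, hp, hp0⟩ := hL
  have hpF : laurentVec μ m p ∈ Fᗮ :=
    (Submodule.orthogonalProjectionOnto_eq_zero_iff).1 hp
  have hin : ∀ y ∈ F, ⟪y, laurentVec μ m p⟫_ℂ = 0 := (Submodule.mem_orthogonal _ _).1 hpF
  refine hp0 (eq_zero_of_laurentVec_eq_zero hμ (m := m) (inner_self_eq_zero.1
    (hpoly p _ ?_ (hin e ?_) (hin d ?_))))
  · exact Submodule.orthogonal_le le_sup_left hpF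
  · exact Submodule.mem_sup_right (Submodule.subset_span (by simp))
  · exact Submodule.mem_sup_right (Submodule.subset_span (by simp))

end Concrete

/-! ### Generalized eigenvectors of normal operators -/

section Normal

variable {E : Type*} [NormedAddCommGroup E] [InnerProductSpace ℂ E] [CompleteSpace E]

theorem isStarNormal_sub_smul_one {A : E →L[ℂ] E} (hA : IsStarNormal A) (c : ℂ) :
    IsStarNormal (A - c • 1) := by
  refine ⟨?_⟩
  have h := hA.star_comm_self.eq
  simp only [star_sub, star_smul, star_one, Commute, SemiconjBy, sub_mul, mul_sub, h,
    smul_mul_assoc, mul_smul_comm, one_mul, mul_one]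
  module

theorem apply_eq_zero_of_apply_apply_eq_zero {N : E →L[ℂ] E} (hN : IsStarNormal N) {x : E}
    (h : N (N x) = 0) : N x = 0 := by
  rw [← ContinuousLinearMap.IsStarNormal.adjoint_apply_eq_zero_iff hN] at h
  rw [← inner_self_eq_zero (𝕜 := ℂ), ← ContinuousLinearMap.adjoint_inner_right, h,
    inner_zero_right]

/-- Generalized eigenvectors of a normal operator are eigenvectors. -/
theorem maxGenEigenspace_eq_eigenspace_of_isStarNormal {A : E →L[ℂ] E} (hA : IsStarNormal A)
    (c : ℂ) : Module.End.maxGenEigenspace (A : E →ₗ[ℂ] E) c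
      = Module.End.eigenspace (A : E →ₗ[ℂ] E) c := by
  refine le_antisymm (fun x hx => ?_) ?_
  · rw [Module.End.mem_maxGenEigenspace] at hx
    obtain ⟨k, hk⟩ := hx
    have hN := isStarNormal_sub_smul_one hA c
    have hone : ((A : E →ₗ[ℂ] E) - c • 1) x = 0 := by
      induction k with
      | zero =>
        have : x = 0 := hk
        rw [this, map_zero]
      | succ k ih =>
        rcases k with _ | k
        · simpa using hk
        · refine ih ?_
          rw [pow_succ', Module.End.mul_apply] at hk ⊢
          rw [pow_succ', Module.End.mul_apply] at hk
          exact apply_eq_zero_of_apply_apply_eq_zero hN hk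
    rw [Module.End.mem_eigenspace_iff]
    exact sub_eq_zero.1 hone
  · exact Module.End.eigenspace_le_maxGenEigenspace

end Normal

/-! ### The spectrum of the truncations on `P_{m,n}` -/

section Spectrum

variable {μ : Measure Circle} [IsFiniteMeasure μ]

theorem paraP_mem_degreeLT (hμ : μ.support.Infinite) (n : ℕ) (u : ℂ) :
    paraP μ (n + 1) u ∈ degreeLT ℂ (n + 1 + 1) := by
  rw [paraP, Nat.add_sub_cancel, C_mul']
  exact Submodule.add_mem _ (X_mul_mem_degreeLT (orthoPoly_mem_degreeLT hμ n))
    (Submodule.smul_mem _ _ (degreeLT_mono (n + 1).le_succ (revOrthoPoly_mem_degreeLT hμ n)))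

theorem paraP_coeff_ne_zero (hμ : μ.support.Infinite) (n : ℕ) (u : ℂ) :
    (paraP μ (n + 1) u).coeff (n + 1) ≠ 0 := by
  have h := revOrthoPoly_mem_degreeLT hμ n
  rw [mem_degreeLT, degree_lt_iff_coeff_zero] at h
  rw [paraP, Nat.add_sub_cancel, coeff_add, coeff_X_mul, coeff_C_mul, h _ le_rfl, mul_zero,
    add_zero]
  exact orthoPoly_coeff_ne_zero hμ n

theorem paraP_ne_zero (hμ : μ.support.Infinite) (n : ℕ) (u : ℂ) : paraP μ (n + 1) u ≠ 0 := by
  intro h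
  apply paraP_coeff_ne_zero hμ n u
  rw [h, coeff_zero]

theorem natDegree_paraP (hμ : μ.support.Infinite) (n : ℕ) (u : ℂ) :
    (paraP μ (n + 1) u).natDegree = n + 1 :=
  natDegree_eq_of_le_of_coeff_ne_zero
    (Nat.lt_succ_iff.1 (natDegree_lt_of_mem_degreeLT (paraP_mem_degreeLT hμ n u)))
    (paraP_coeff_ne_zero hμ n u)

theorem mem_degreeLT_of_mul_eq_paraP (hμ : μ.support.Infinite) {n : ℕ} {u z : ℂ} {r : ℂ[X]}
    (h : paraP μ (n + 1) u = (X - C z) * r) : r ∈ degreeLT ℂ (n + 1) := by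
  have h0 := paraP_ne_zero hμ n u
  have hd := natDegree_paraP hμ n u
  rw [h] at h0 hd
  rw [natDegree_mul (left_ne_zero_of_mul h0) (right_ne_zero_of_mul h0), natDegree_X_sub_C] at hd
  rw [mem_degreeLT, degree_eq_natDegree (right_ne_zero_of_mul h0)]
  exact_mod_cast (by omega : r.natDegree < n + 1)

/-- The truncation on `P_{m,n}` is multiplication by `z` modulo `p_n^u`. -/
theorem skewTrunc_laurentVec_eq_iff (hμ : μ.support.Infinite) (m : ℤ) (n : ℕ) (u : ℂ)
    {p r : ℂ[X]} (hp : p ∈ degreeLT ℂ (n + 1)) (hr : r ∈ degreeLT ℂ (n + 1)) :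
    (isDefectData_laurentSpan hμ m n).skewTrunc u ⟨_, laurentVec_mem_laurentSpan hp⟩
        = ⟨_, laurentVec_mem_laurentSpan hr⟩ ↔
      ∃ c : ℂ, X * p - r = C c * paraP μ (n + 1) u := by
  have h := isDefectData_laurentSpan hμ m n
  have hP := laurentVec_mem_laurentSpan (μ := μ) (m := m) (paraP_mem_degreeLT hμ n u)
  have hd : X * p - r ∈ degreeLT ℂ (n + 1 + 1) :=
    Submodule.sub_mem _ (X_mul_mem_degreeLT hp) (degreeLT_mono (n + 1).le_succ hr)
  have hker := h.mem_ker_skewProj_iff u (x := laurentVec μ m (X * p - r))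
  rw [laurentSpan_sup_span hμ, mulOp_add_smul_eq_paraP] at hker
  have hlhs : (h.skewTrunc u ⟨_, laurentVec_mem_laurentSpan hp⟩
      = ⟨_, laurentVec_mem_laurentSpan hr⟩) ↔
      skewProj (laurentSpan μ m (n + 1)) (laurentVec μ m (revPoly n (orthoPoly μ n)))
        (laurentVec μ m (orthoPoly μ (n + 1))) (rho μ (n + 1)) (schurParam μ (n + 1)) u
        (laurentVec μ m (X * p - r)) = 0 := by
    rw [← Subtype.coe_inj, h.skewTrunc_apply, laurentVec_sub, map_sub,
      h.skewProj_of_mem u (laurentVec_mem_laurentSpan hr), sub_eq_zero, mulOp_laurentVec]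
  rw [hlhs, hker]
  constructor
  · intro hx
    obtain ⟨y, hy, z, hz, hyz⟩ := Submodule.mem_sup.1 hx
    obtain ⟨c, rfl⟩ := Submodule.mem_span_singleton.1 hy
    have hzmem : z ∈ laurentSpan μ m (n + 1 + 1) := by
      rw [← add_sub_cancel_left (c • laurentVec μ m (paraP μ (n + 1) u)) z, hyz]
      exact Submodule.sub_mem _ (laurentVec_mem_laurentSpan hd) (Submodule.smul_mem _ _ hP)
    have hz0 : z = 0 := inner_self_eq_zero.1 ((Submodule.mem_orthogonal _ _).1 hz z hzmem)
    refine ⟨c, laurentVec_injective hμ m ?_⟩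
    rw [← hyz, hz0, add_zero, laurentVec_C_mul]
  · rintro ⟨c, hc⟩
    rw [hc, laurentVec_C_mul]
    exact Submodule.mem_sup_left
      (Submodule.smul_mem _ _ (Submodule.mem_span_singleton_self _))

/-- The eigenvalue equation in polynomial form. -/
theorem skewTrunc_laurentVec_eq_smul_iff (hμ : μ.support.Infinite) (m : ℤ) (n : ℕ) (u z : ℂ)
    {p : ℂ[X]} (hp : p ∈ degreeLT ℂ (n + 1)) :
    (isDefectData_laurentSpan hμ m n).skewTrunc u ⟨_, laurentVec_mem_laurentSpan hp⟩
        = z • ⟨_, laurentVec_mem_laurentSpan hp⟩ ↔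
      ∃ c : ℂ, (X - C z) * p = C c * paraP μ (n + 1) u := by
  have hz : C z * p ∈ degreeLT ℂ (n + 1) := by
    rw [C_mul']
    exact Submodule.smul_mem _ _ hp
  have h1 : z • (⟨_, laurentVec_mem_laurentSpan hp⟩ : laurentSpan μ m (n + 1))
      = ⟨_, laurentVec_mem_laurentSpan hz⟩ := Subtype.ext (laurentVec_C_mul μ m z p).symm
  rw [h1, skewTrunc_laurentVec_eq_iff hμ m n u hp hz, sub_mul]

theorem mem_spectrum_iff_exists {E : Type*} [NormedAddCommGroup E] [NormedSpace ℂ E]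
    [FiniteDimensional ℂ E] (A : E →L[ℂ] E) (z : ℂ) :
    z ∈ spectrum ℂ A ↔ ∃ x, A x = z • x ∧ x ≠ 0 := by
  have h : spectrum ℂ A = spectrum ℂ (A : Module.End ℂ E) :=
    AlgEquiv.spectrum_eq (Module.End.toContinuousLinearMap (𝕜 := ℂ) E) (A : Module.End ℂ E)
  rw [h, ← Module.End.hasEigenvalue_iff_mem_spectrum]
  constructor
  · intro hz
    obtain ⟨x, hx⟩ := hz.exists_hasEigenvector
    exact ⟨x, hx.apply_eq_smul, hx.2⟩
  · rintro ⟨x, hx, hx0⟩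
    exact Module.End.hasEigenvalue_of_hasEigenvector ⟨Module.End.mem_eigenspace_iff.2 hx, hx0⟩

/-- The eigenvectors for a zero `z` of `p_n^u` are the multiples of `p_n^u / (X - z)`. -/
theorem spectrum_skewTrunc (hμ : μ.support.Infinite) (m : ℤ) (n : ℕ) (u : ℂ) :
    spectrum ℂ ((isDefectData_laurentSpan hμ m n).skewTrunc u)
      = {z : ℂ | (paraP μ (n + 1) u).IsRoot z} := by
  ext z
  rw [mem_spectrum_iff_exists, Set.mem_ofPred_eq]
  constructor
  · rintro ⟨⟨x, hx⟩, hxz, hx0⟩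
    obtain ⟨p, hp, rfl⟩ := (mem_laurentSpan_iff μ).1 hx
    obtain ⟨c, hc⟩ := (skewTrunc_laurentVec_eq_smul_iff hμ m n u z hp).1 hxz
    have hp0 : p ≠ 0 := by
      rintro rfl
      exact hx0 (Subtype.ext (laurentVec_zero μ m))
    have hc0 : c ≠ 0 := by
      rintro rfl
      rw [C_0, zero_mul] at hc
      exact (mul_ne_zero (X_sub_C_ne_zero z) hp0) hc
    have h0 := congrArg (eval z) hc
    rw [eval_mul, eval_sub, eval_X, eval_C, sub_self, zero_mul, eval_mul, eval_C] at h0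
    exact (mul_eq_zero.1 h0.symm).resolve_left hc0
  · intro hz
    obtain ⟨r, hr⟩ := dvd_iff_isRoot.2 hz
    have hrd := mem_degreeLT_of_mul_eq_paraP hμ hr
    refine ⟨⟨_, laurentVec_mem_laurentSpan hrd⟩,
      (skewTrunc_laurentVec_eq_smul_iff hμ m n u z hrd).2 ⟨1, by rw [C_1, one_mul, hr]⟩, ?_⟩
    intro h0
    have hr0 : r = 0 := eq_zero_of_laurentVec_eq_zero hμ (m := m) (congrArg Subtype.val h0)
    rw [hr0, mul_zero] at hr
    exact paraP_ne_zero hμ n u hr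

/-- A double zero `z` of `p_n^u` would give a generalized eigenvector `p_n^u / (X - z)^2` of a
normal operator that is not an eigenvector. -/
theorem nodup_roots_paraP (hμ : μ.support.Infinite) (n : ℕ) {u : ℂ} (hu : ‖u‖ = 1) :
    (paraP μ (n + 1) u).roots.Nodup := by
  classical
  rw [Multiset.nodup_iff_count_le_one]
  intro z
  rw [count_roots]
  by_contra! hlt
  obtain ⟨s, hs⟩ := (le_rootMultiplicity_iff (paraP_ne_zero hμ n u)).1 hlt
  rw [sq, mul_assoc] at hs
  have hrd := mem_degreeLT_of_mul_eq_paraP hμ hs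
  have hne : (X - C z) * s ≠ 0 := right_ne_zero_of_mul (hs ▸ paraP_ne_zero hμ n u)
  have hsd : s ∈ degreeLT ℂ (n + 1) := by
    rw [mem_degreeLT] at hrd ⊢
    refine lt_of_le_of_lt ?_ hrd
    rw [degree_mul, degree_X_sub_C, degree_eq_natDegree (right_ne_zero_of_mul hne)]
    exact_mod_cast Nat.le_add_left _ _
  set V := (isDefectData_laurentSpan hμ 0 n).skewTrunc u with hV
  have hzs : C z * s ∈ degreeLT ℂ (n + 1) := by
    rw [C_mul']
    exact Submodule.smul_mem _ _ hsd
  -- `V - z` maps `s = p_n^u / (X - z)^2` to the eigenvector `(X - z) s`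
  have h1 : V ⟨_, laurentVec_mem_laurentSpan hsd⟩
      = ⟨_, laurentVec_mem_laurentSpan (Submodule.add_mem _ hzs hrd)⟩ :=
    (skewTrunc_laurentVec_eq_iff hμ 0 n u hsd (Submodule.add_mem _ hzs hrd)).2
      ⟨0, by rw [C_0, zero_mul]; ring⟩
  have h2 : V ⟨_, laurentVec_mem_laurentSpan hrd⟩ = z • ⟨_, laurentVec_mem_laurentSpan hrd⟩ :=
    (skewTrunc_laurentVec_eq_smul_iff hμ 0 n u z hrd).2 ⟨1, by rw [C_1, one_mul, hs]⟩
  have h3 : (V - z • 1) ⟨_, laurentVec_mem_laurentSpan hsd⟩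
      = ⟨_, laurentVec_mem_laurentSpan hrd⟩ := by
    rw [sub_apply, h1]
    refine Subtype.ext ?_
    change laurentVec μ 0 _ - z • laurentVec μ 0 s = _
    rw [laurentVec_add, laurentVec_C_mul, add_sub_cancel_left]
  have h4 : (V - z • 1) ⟨_, laurentVec_mem_laurentSpan hrd⟩ = 0 := by
    rw [sub_apply, h2]
    exact sub_self _
  have h5 := apply_eq_zero_of_apply_apply_eq_zero
    (isStarNormal_sub_smul_one ((isDefectData_laurentSpan hμ 0 n).isStarNormal_skewTrunc hu) z)
    (h3 ▸ h4)
  rw [h3] at h5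
  exact hne (eq_zero_of_laurentVec_eq_zero hμ (m := 0) (congrArg Subtype.val h5))

theorem ncard_spectrum_skewTrunc (hμ : μ.support.Infinite) (m : ℤ) (n : ℕ) {u : ℂ}
    (hu : ‖u‖ = 1) :
    (spectrum ℂ ((isDefectData_laurentSpan hμ m n).skewTrunc u)).ncard = n + 1 := by
  classical
  have h : {z : ℂ | (paraP μ (n + 1) u).IsRoot z}
      = ((paraP μ (n + 1) u).roots.toFinset : Set ℂ) := by
    ext z
    simp [paraP_ne_zero hμ n u]
  rw [spectrum_skewTrunc hμ, h, Set.ncard_coe_finset,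
    Multiset.toFinset_card_of_nodup (nodup_roots_paraP hμ n hu),
    ← (IsAlgClosed.splits (paraP μ (n + 1) u)).natDegree_eq_card_roots, natDegree_paraP hμ]

theorem finrank_maxGenEigenspace_skewTrunc (hμ : μ.support.Infinite) (m : ℤ) (n : ℕ) {u : ℂ}
    (hu : ‖u‖ = 1) {z : ℂ}
    (hz : z ∈ spectrum ℂ ((isDefectData_laurentSpan hμ m n).skewTrunc u)) :
    Module.finrank ℂ (Module.End.maxGenEigenspace
      ((isDefectData_laurentSpan hμ m n).skewTrunc u :
        laurentSpan μ m (n + 1) →ₗ[ℂ] laurentSpan μ m (n + 1)) z) = 1 := by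
  rw [maxGenEigenspace_eq_eigenspace_of_isStarNormal 
    ((isDefectData_laurentSpan hμ m n).isStarNormal_skewTrunc hu)]
  rw [spectrum_skewTrunc hμ] at hz
  obtain ⟨r, hr⟩ := dvd_iff_isRoot.2 hz
  have hrd := mem_degreeLT_of_mul_eq_paraP hμ hr
  have hr0 : r ≠ 0 := right_ne_zero_of_mul (hr ▸ paraP_ne_zero hμ n u)
  set v : laurentSpan μ m (n + 1) := ⟨_, laurentVec_mem_laurentSpan hrd⟩ with hv
  have hv0 : v ≠ 0 := fun h0 =>
    hr0 (eq_zero_of_laurentVec_eq_zero hμ (m := m) (congrArg Subtype.val h0))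
  suffices h : Module.End.eigenspace ((isDefectData_laurentSpan hμ m n).skewTrunc u :
      laurentSpan μ m (n + 1) →ₗ[ℂ] laurentSpan μ m (n + 1)) z = Submodule.span ℂ {v} by
    rw [h, finrank_span_singleton hv0]
  refine le_antisymm ?_ ?_
  · rintro ⟨x, hx⟩ hxz
    obtain ⟨p, hp, rfl⟩ := (mem_laurentSpan_iff μ).1 hx
    obtain ⟨c, hc⟩ := (skewTrunc_laurentVec_eq_smul_iff hμ m n u z hp).1
      (Module.End.mem_eigenspace_iff.1 hxz)
    have hpr : p = C c * r := by
      refine mul_left_cancel₀ (X_sub_C_ne_zero z) ?_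
      rw [hc, hr]
      ring
    refine Submodule.mem_span_singleton.2 ⟨c, Subtype.ext ?_⟩
    change c • laurentVec μ m r = laurentVec μ m p
    rw [hpr, laurentVec_C_mul]
  · rw [Submodule.span_singleton_le_iff_mem, Module.End.mem_eigenspace_iff]
    exact (skewTrunc_laurentVec_eq_smul_iff hμ m n u z hrd).2 ⟨1, by rw [C_1, one_mul, hr]⟩

end Spectrum

end OPUC

theorem theorem2p2 (μ : MeasureTheory.Measure Circle) [MeasureTheory.IsFiniteMeasure μ]
    (hμ : μ.support.Infinite) (m : ℤ) (n : ℕ) (hn : 1 ≤ n) :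
    -- truncations on `P_{m,n}`
    (∃ (Q : Circle → (OPUC.L2 μ →L[ℂ] OPUC.L2 μ))
        (V : Circle → (OPUC.laurentSpan μ m n →L[ℂ] OPUC.laurentSpan μ m n)),
      (∀ u : Circle,
        (Submodule.span ℂ {OPUC.laurentVec μ m (OPUC.paraP μ n u)}) ⟂
            (OPUC.laurentSpan μ m (n + 1))ᗮ ∧
        OPUC.IsProjAlong (Q u : OPUC.L2 μ →ₗ[ℂ] OPUC.L2 μ) (OPUC.laurentSpan μ m n)
          (Submodule.span ℂ {OPUC.laurentVec μ m (OPUC.paraP μ n u)} ⊔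
            (OPUC.laurentSpan μ m (n + 1))ᗮ) ∧
        OPUC.IsTruncationFor (OPUC.mulOp μ) (OPUC.laurentSpan μ m n)
          (Q u : OPUC.L2 μ →ₗ[ℂ] OPUC.L2 μ) (V u) ∧
        V u ∈ unitary (OPUC.laurentSpan μ m n →L[ℂ] OPUC.laurentSpan μ m n) ∧
        ‖Q u‖ = Real.sqrt (1 + ‖(u : ℂ) - OPUC.schurParam μ n‖ ^ 2 / OPUC.rho μ n ^ 2) ∧
        -- the spectrum consists of the zeros of `p_n^u`, and it is simple
        spectrum ℂ (V u) = {z : ℂ | (OPUC.paraP μ n u).IsRoot z} ∧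
        (spectrum ℂ (V u)).ncard = n ∧
        ∀ z ∈ spectrum ℂ (V u), Module.finrank ℂ (Module.End.maxGenEigenspace
          (V u : OPUC.laurentSpan μ m n →ₗ[ℂ] OPUC.laurentSpan μ m n) z) = 1) ∧
      -- `u ↦ V u` is a bijection onto the unitary truncations and, if `3 ≤ n`, onto the normal ones
      Set.BijOn V Set.univ
        {A | OPUC.IsTruncationOn (OPUC.mulOp μ) (OPUC.laurentSpan μ m n) A ∧
          A ∈ unitary (OPUC.laurentSpan μ m n →L[ℂ] OPUC.laurentSpan μ m n)} ∧
      (3 ≤ n → Set.BijOn V Set.univ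
        {A | OPUC.IsTruncationOn (OPUC.mulOp μ) (OPUC.laurentSpan μ m n) A ∧ IsStarNormal A})) ∧
    -- truncations on the orthogonal complement of `P_{m,n}`
    (∃ (Q : Circle → (OPUC.L2 μ →L[ℂ] OPUC.L2 μ))
        (V : Circle → ((OPUC.laurentSpan μ m n)ᗮ →L[ℂ] (OPUC.laurentSpan μ m n)ᗮ)),
      (∀ u : Circle,
        (Submodule.span ℂ {OPUC.laurentVec μ m (OPUC.paraQ μ n u)}) ⟂
            (OPUC.laurentSpan μ (m + 1) (n - 1)) ∧
        OPUC.IsProjAlong (Q u : OPUC.L2 μ →ₗ[ℂ] OPUC.L2 μ) (OPUC.laurentSpan μ m n)ᗮ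
          (Submodule.span ℂ {OPUC.laurentVec μ m (OPUC.paraQ μ n u)} ⊔
            OPUC.laurentSpan μ (m + 1) (n - 1)) ∧
        OPUC.IsTruncationFor (OPUC.mulOp μ) (OPUC.laurentSpan μ m n)ᗮ
          (Q u : OPUC.L2 μ →ₗ[ℂ] OPUC.L2 μ) (V u) ∧
        V u ∈ unitary ((OPUC.laurentSpan μ m n)ᗮ →L[ℂ] (OPUC.laurentSpan μ m n)ᗮ) ∧
        ‖Q u‖ = Real.sqrt (1 + ‖(u : ℂ) - OPUC.schurParam μ n‖ ^ 2 / OPUC.rho μ n ^ 2)) ∧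
      Set.BijOn V Set.univ
        {A | OPUC.IsTruncationOn (OPUC.mulOp μ) (OPUC.laurentSpan μ m n)ᗮ A ∧
          IsStarNormal A}) := by
  obtain ⟨n, rfl⟩ : ∃ k, n = k + 1 := ⟨n - 1, by omega⟩
  refine ⟨?_, ?_⟩
  · have h := OPUC.isDefectData_laurentSpan hμ m n
    have hmaps : ∀ u : Circle, h.skewTrunc (u : ℂ) ∈ unitary _ := fun u =>
      h.skewTrunc_mem_unitary u.norm_coe
    have hinj : Function.Injective fun u : Circle => h.skewTrunc (u : ℂ) :=
      h.skewTrunc_injective.comp Circle.coe_injective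
    have hsurj : ∀ A, OPUC.IsTruncationOn (OPUC.mulOp μ) (OPUC.laurentSpan μ m (n + 1)) A →
        A ∈ unitary _ → ∃ u : Circle, h.skewTrunc (u : ℂ) = A := by
      intro A hA hAu
      obtain ⟨w, hw, hwA⟩ := h.exists_eq_skewTrunc hA hAu
      exact ⟨⟨w, mem_sphere_zero_iff_norm.2 hw⟩, hwA⟩
    refine ⟨fun u => OPUC.skewProj _ _ _ _ _ (u : ℂ), fun u => h.skewTrunc (u : ℂ),
      fun u => ⟨?_, ?_, h.isTruncationFor_skewTrunc u, hmaps u, h.norm_skewProj u,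
        OPUC.spectrum_skewTrunc hμ m n u, OPUC.ncard_spectrum_skewTrunc hμ m n u.norm_coe,
        fun z hz => OPUC.finrank_maxGenEigenspace_skewTrunc hμ m n u.norm_coe hz⟩,
      ⟨?_, hinj.injOn, ?_⟩, fun hn3 => ⟨?_, hinj.injOn, ?_⟩⟩
    · have := h.span_isOrtho (u : ℂ)
      rwa [OPUC.laurentSpan_sup_span hμ, OPUC.mulOp_add_smul_eq_paraP] at this
    · have := h.isProjAlong_skewProj (u : ℂ)
      rwa [OPUC.laurentSpan_sup_span hμ, OPUC.mulOp_add_smul_eq_paraP] at this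
    · exact fun u _ => ⟨h.isTruncationOn_skewTrunc u, hmaps u⟩
    · rintro A ⟨hA, hAu⟩
      obtain ⟨u, hu⟩ := hsurj A hA hAu
      exact ⟨u, Set.mem_univ u, hu⟩
    · exact fun u _ => ⟨h.isTruncationOn_skewTrunc u, h.isStarNormal_skewTrunc u.norm_coe⟩
    · rintro A ⟨hA, hAn⟩
      obtain ⟨u, hu⟩ := hsurj A hA
        (OPUC.mem_unitary_of_isStarNormal_laurentSpan hμ (by omega) hA hAn)
      exact ⟨u, Set.mem_univ u, hu⟩
  · have h := OPUC.isDefectData_laurentSpan_orthogonal hμ m n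
    -- in the unified parametrization the point `u` of the circle corresponds to `-conj u`
    have hnorm : ∀ u : Circle, ‖-starRingEnd ℂ (u : ℂ)‖ = 1 := fun u => by
      rw [norm_neg, RCLike.norm_conj, u.norm_coe]
    have hmaps : ∀ u : Circle, h.skewTrunc (-starRingEnd ℂ (u : ℂ)) ∈ unitary _ := fun u =>
      h.skewTrunc_mem_unitary (hnorm u)
    refine ⟨fun u => OPUC.skewProj _ _ _ _ _ (-starRingEnd ℂ (u : ℂ)),
      fun u => h.skewTrunc (-starRingEnd ℂ (u : ℂ)),
      fun u => ⟨?_, ?_, h.isTruncationFor_skewTrunc _, hmaps u, ?_⟩, ?_, ?_, ?_⟩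
    · have := h.span_isOrtho (-starRingEnd ℂ (u : ℂ))
      rwa [OPUC.orthogonal_laurentSpan_orthogonal_sup_span hμ,
        OPUC.mulOp_add_smul_eq_paraQ] at this
    · have := h.isProjAlong_skewProj (-starRingEnd ℂ (u : ℂ))
      rwa [OPUC.orthogonal_laurentSpan_orthogonal_sup_span hμ,
        OPUC.mulOp_add_smul_eq_paraQ] at this
    · refine (h.norm_skewProj _).trans ?_
      rw [← neg_add', norm_neg, ← sub_eq_add_neg, ← map_sub, RCLike.norm_conj]
    · exact fun u _ => ⟨h.isTruncationOn_skewTrunc _, h.isStarNormal_skewTrunc (hnorm u)⟩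
    · intro u _ u' _ huu
      exact Circle.coe_injective ((starRingEnd ℂ).injective
        (neg_injective (h.skewTrunc_injective huu)))
    · rintro A ⟨hA, hAn⟩
      obtain ⟨w, hw, hwA⟩ := h.exists_eq_skewTrunc hA
        (OPUC.mem_unitary_of_isStarNormal_laurentSpan_orthogonal hμ hA hAn)
      refine ⟨⟨-starRingEnd ℂ w, mem_sphere_zero_iff_norm.2 ?_⟩, Set.mem_univ _, ?_⟩
      · rw [norm_neg, RCLike.norm_conj, hw]
      · rw [← hwA]
        change h.skewTrunc (-starRingEnd ℂ (-starRingEnd ℂ w)) = _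
        rw [map_neg, Complex.conj_conj, neg_neg]
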